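/- **Setting.** There are $K\ge 1$ arms and $T$ rounds. In each round $t=1,\dots,T$ a reward vector $(r_{t,k})_{k\in[K]}\in[0,1]^K$ is drawn from a fixed unknown distribution, independently of the past. An adversary who knows the whole past (rewards, corrupted rewards and pulled arms) and the current reward vector replaces it by a corrupted vector $(\tilde r_{t,k})_{k\in[K]}\in[0,1]^K$; the adversary may be adaptive and randomized. The learner then draws an arm $I_t$ using fresh randomness, and $\tilde r_{t,I_t}$ is revealed to it at the end of the current batch. Let $\mu_k=\mathbb E[r_{t,k}]$, $\Delta_k=\max_j\mu_j-\mu_k$, $\Delta=\min_{k:\Delta_k>0}\Delta_k$, $C=\sum_{t=1}^T\max_k|\tilde r_{t,k}-r_{t,k}|$, and $$R(T)=\max_{k}\mathbb E\Big[\sum_{t=1}^T r_{t,k}\Big]-\mathbb E\Big[\sum_{t=1}^T r_{t,I_t}\Big].$$ **Algorithm (BB-BARBAT)** with horizon $T$ and $L$ batches. Let $a=\max\{T^{1/(2(L+3))},2\}$ and, for $m\ge1$, $\zeta_m=(m+4)a^{2(m+4)}\ln(aK)$, $\delta_m=1/(K\zeta_m)$, $\lambda_m=a^8\ln(4K/\delta_m)$,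 $\beta_m=\delta_m/K$, $N_m=\lceil K\lambda_m a^{2(m-1)}\rceil$, $T_0=0$, $T_m=T_{m-1}+N_m$. Start with $r_k^0=0$ and $\Delta_k^0=1$ for all $k$. Epoch $m\ge 1$ is the batch of rounds $T_{m-1}<t\le T_m$ (cut off at $T$). Let $k_m$ be the arm maximizing $r_k^{m-1}$ (smallest index in case of ties), $n_k^m=\lambda_m(\Delta_k^{m-1})^{-2}$, $\tilde n_k^m=n_k^m$ for $k\ne k_m$ and $\tilde n_{k_m}^m=N_m-\sum_{k\ne k_m}n_k^m$. In each round of the epoch, $I_t=k$ with probability $\tilde n_k^m/N_m$. After the epoch, with $S_k^m$ the sum of the observed corrupted rewards of arm $k$ in it, put $r_k^m=\min\{S_k^m/\tilde n_k^m,1\}$, $r_*^m=\max_k\{r_k^m-\sqrt{4\ln(4/\beta_m)/\tilde n_k^m}\}$ and $\Delta_k^m=\max\{a^{-m},r_*^m-r_k^m\}$. **Theorem.** Let $1\le L\le\log_2 T$. Then BB-BARBAT uses at most $L$ batches, whose boundaries are fixed in advance (that is, $T\le T_L$), and $$R(T)=O\bigg(\mathbb E[C]\,T^{\frac1{L+3}}+T^{\frac4{L+3}}\bigg(\sum_{k:\Delta_k>0}\frac{L\log(KT)}{\Delta_k}+\frac{K\log(T)\log(1/\Delta)\log(K/\Delta)}{L\Delta}\bigg)\bigg),$$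 where the constant in $O(\cdot)$ is absolute: it does not depend on $K$, $T$, $L$, the reward distribution or the adversary. (If all arms are optimal, the terms containing gaps are read as $0$.) In particular $\mathbb E[C]$ may be replaced by any almost sure upper bound on $C$. -/

import Mathlib

open MeasureTheory ProbabilityTheory

noncomputable section

namespace BBBarbat

/-! ### Stochastic bandit instances

Arms are the elements of `Fin K`; an instance is the law `ν` of one reward vector. -/

/-- Mean reward `μ_k` of arm `k`. -/
def mean {K : ℕ} (ν : Measure (Fin K → ℝ)) (k : Fin K) : ℝ := ∫ x, x k ∂ν

/-- Suboptimality gap `Δ_k = max_j μ_j - μ_k`. -/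
def gap {K : ℕ} (ν : Measure (Fin K → ℝ)) (k : Fin K) : ℝ := (⨆ j, mean ν j) - mean ν k

/-- The smallest positive gap `Δ` (equal to `0` if every arm is optimal). -/
def minGap {K : ℕ} (ν : Measure (Fin K → ℝ)) : ℝ := sInf {x | ∃ k, 0 < gap ν k ∧ x = gap ν k}

/-! ### Parameters of the algorithm

Epochs are numbered `m = 1, 2, …`; each epoch is one batch. -/

/-- `a = max {T ^ (1 / (2 (L + 3))), 2}`. -/
def base (T L : ℕ) : ℝ := max ((T : ℝ) ^ (1 / (2 * ((L : ℝ) + 3)))) 2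

/-- `ζ_m = (m + 4) a ^ (2 (m + 4)) ln (a K)`. -/
def zeta (K T L m : ℕ) : ℝ :=
  ((m : ℝ) + 4) * base T L ^ (2 * (m + 4)) * Real.log (base T L * K)

/-- `δ_m = 1 / (K ζ_m)`. -/
def delta (K T L m : ℕ) : ℝ := 1 / (K * zeta K T L m)

/-- `λ_m = a ^ 8 ln (4 K / δ_m)`. -/
def lam (K T L m : ℕ) : ℝ := base T L ^ 8 * Real.log (4 * K / delta K T L m)

/-- `β_m = δ_m / K`. -/
def beta (K T L m : ℕ) : ℝ := delta K T L m / K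

/-- The length `N_m = ⌈K λ_m a ^ (2 (m - 1))⌉` of epoch `m ≥ 1`. -/
def epochLen (K T L m : ℕ) : ℕ := ⌈(K : ℝ) * lam K T L m * base T L ^ (2 * (m - 1))⌉₊

/-- The last round `T_m` of epoch `m`, with `T_0 = 0`; epoch `m ≥ 1` consists of the rounds
`T_{m-1} < t ≤ T_m`. -/
def epochEnd (K T L : ℕ) : ℕ → ℕ
  | 0 => 0
  | m + 1 => epochEnd K T L m + epochLen K T L (m + 1)

/-! ### The algorithm -/

/-- The data carried from one epoch to the next: the estimated rewards `r_k^m` and the estimated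
gaps `Δ_k^m`. -/
structure Estimates (K : ℕ) where
  /-- The estimated rewards `r_k^m`. -/
  reward : Fin K → ℝ
  /-- The estimated gaps `Δ_k^m`. -/
  gap : Fin K → ℝ

lemma exists_maximizer {K : ℕ} [NeZero K] (r : Fin K → ℝ) :
    (Finset.univ.filter fun k => ∀ j, r j ≤ r k).Nonempty := by
  obtain ⟨k, hk⟩ := Finite.exists_max r
  exact ⟨k, by simpa using hk⟩

/-- The arm with the largest estimated reward; ties are broken by the smallest index. -/
def bestArm {K : ℕ} [NeZero K] (r : Fin K → ℝ) : Fin K :=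
  (Finset.univ.filter fun k => ∀ j, r j ≤ r k).min' (exists_maximizer r)

/-- `n_k^m = λ_m (Δ_k^{m-1}) ^ (-2)`, where `e` holds the estimates made after epoch `m - 1`. -/
def basePulls {K : ℕ} (T L m : ℕ) (e : Estimates K) (k : Fin K) : ℝ :=
  lam K T L m / e.gap k ^ 2

/-- `ñ_k^m`: all pulls left over by the other arms go to the arm that looks best. -/
def pulls {K : ℕ} [NeZero K] (T L m : ℕ) (e : Estimates K) (k : Fin K) : ℝ :=
  if k = bestArm e.reward then
    (epochLen K T L m : ℝ) - ∑ j ∈ Finset.univ.erase k, basePulls T L m e j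
  else basePulls T L m e k

/-- The estimates after epoch `m`, as a function of the pulled arms and of the observed (corrupted)
rewards of the pulled arms. Only the rounds `1 ≤ t ≤ T_m` matter. -/
def estimates {K : ℕ} [NeZero K] (T L : ℕ) (arm : ℕ → Fin K) (obs : ℕ → ℝ) : ℕ → Estimates K
  | 0 => { reward := fun _ => 0, gap := fun _ => 1 }
  | m + 1 =>
    let n : Fin K → ℝ := pulls T L (m + 1) (estimates T L arm obs m)
    let S : Fin K → ℝ := fun k =>
      ∑ t ∈ Finset.Ioc (epochEnd K T L m) (epochEnd K T L (m + 1)),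
        if arm t = k then obs t else 0
    let r : Fin K → ℝ := fun k => min (S k / n k) 1
    let rStar : ℝ := ⨆ k, (r k - √(4 * Real.log (4 / beta K T L (m + 1)) / n k))
    { reward := r
      gap := fun k => max ((base T L)⁻¹ ^ (m + 1)) (rStar - r k) }

/-- The probability `p_m(k) = ñ_k^m / N_m` with which arm `k` is chosen in each round of
epoch `m ≥ 1`. It depends only on what was observed in the epochs before `m`. -/
def armProb {K : ℕ} [NeZero K] (T L : ℕ) (arm : ℕ → Fin K) (obs : ℕ → ℝ) (m : ℕ) (k : Fin K) : ℝ :=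
  pulls T L m (estimates T L arm obs (m - 1)) k / epochLen K T L m

/-! ### The interaction of the algorithm with the environment and the adversary

`r t ω k` is the reward and `rt t ω k` the corrupted reward of arm `k` in round `t`, and `I t ω` is
the pulled arm. Rounds are numbered `1, …, T`. -/

/-- Everything that happened before round `t`: all rewards, corrupted rewards and pulled arms. -/
abbrev history {K : ℕ} {Ω : Type*} (r rt : ℕ → Ω → Fin K → ℝ) (I : ℕ → Ω → Fin K) (t : ℕ) :
    MeasurableSpace Ω :=
  ⨆ s ∈ Finset.Ico 1 t,
    MeasurableSpace.comap (r s) inferInstance ⊔ MeasurableSpace.comap (rt s) inferInstance ⊔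
      MeasurableSpace.comap (I s) inferInstance

/-- `(r, rt, I)` is a run of BB-BARBAT for `T` rounds and `L` batches on the instance `ν`, against
an adaptive and possibly randomized adversary. In round `t`, a reward vector with law `ν` is drawn
independently of the past; the adversary, who knows the past and this vector, puts an arbitrary
vector `rt t` with entries in `[0, 1]` in its place; independently of `r t` and `rt t` given the
past, the algorithm then draws its arm from its current distribution. -/
structure IsRun {K : ℕ} [NeZero K] {Ω : Type*} [MeasurableSpace Ω] (T L : ℕ)
    (ν : Measure (Fin K → ℝ)) (P : Measure Ω) (r rt : ℕ → Ω → Fin K → ℝ) (I : ℕ → Ω → Fin K) :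
    Prop where
  measurable_reward : ∀ t ∈ Finset.Icc 1 T, Measurable (r t)
  measurable_corrupted : ∀ t ∈ Finset.Icc 1 T, Measurable (rt t)
  measurable_arm : ∀ t ∈ Finset.Icc 1 T, Measurable (I t)
  reward_law : ∀ t ∈ Finset.Icc 1 T, P.map (r t) = ν
  reward_indep : ∀ t ∈ Finset.Icc 1 T,
    Indep (MeasurableSpace.comap (r t) inferInstance) (history r rt I t) P
  corrupted_mem : ∀ t ∈ Finset.Icc 1 T, ∀ᵐ ω ∂P, ∀ k, rt t ω k ∈ Set.Icc (0 : ℝ) 1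
  arm_law : ∀ m, 1 ≤ m → ∀ t ∈ Finset.Icc 1 T, epochEnd K T L (m - 1) < t → t ≤ epochEnd K T L m →
    ∀ k, P[(I t ⁻¹' {k}).indicator (fun _ => (1 : ℝ)) |
        history r rt I t ⊔ MeasurableSpace.comap (r t) inferInstance ⊔
          MeasurableSpace.comap (rt t) inferInstance]
      =ᵐ[P] fun ω => armProb T L (fun s => I s ω) (fun s => rt s ω (I s ω)) m k

/-- The corruption level `C = ∑_t max_k |r̃_{t,k} - r_{t,k}|` of an outcome. -/
def corruption {K : ℕ} {Ω : Type*} (T : ℕ) (r rt : ℕ → Ω → Fin K → ℝ) (ω : Ω) : ℝ :=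
  ∑ t ∈ Finset.Icc 1 T, ⨆ k, |rt t ω k - r t ω k|

/-- The pseudo-regret `R(T) = max_k E[∑_t r_{t,k}] - E[∑_t r_{t,I_t}]`. -/
def regret {K : ℕ} {Ω : Type*} [MeasurableSpace Ω] (T : ℕ) (P : Measure Ω)
    (r : ℕ → Ω → Fin K → ℝ) (I : ℕ → Ω → Fin K) : ℝ :=
  (⨆ k, ∫ ω, ∑ t ∈ Finset.Icc 1 T, r t ω k ∂P) - ∫ ω, ∑ t ∈ Finset.Icc 1 T, r t ω (I t ω) ∂P

end BBBarbat

end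

set_option linter.unusedSectionVars false

namespace BBBarbat

section Parameters

variable {K T L : ℕ}

lemma two_le_base : 2 ≤ base T L := le_max_right _ _

lemma base_pos : 0 < base T L := lt_of_lt_of_le two_pos two_le_base

lemma one_le_base : 1 ≤ base T L := one_le_two.trans two_le_base

lemma log_two_le_log_base : Real.log 2 ≤ Real.log (base T L) :=
  Real.log_le_log two_pos two_le_base

lemma log_base_pos : 0 < Real.log (base T L) :=
  lt_of_lt_of_le (Real.log_pos one_lt_two) log_two_le_log_base

/-- The logarithm `ln (4 K / δ_m) = ln (4 / β_m)` shared by `λ_m` and the confidence radii. -/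
noncomputable def logTerm (K T L m : ℕ) : ℝ := Real.log (4 * K / delta K T L m)

lemma lam_eq (m : ℕ) : lam K T L m = base T L ^ 8 * logTerm K T L m := rfl

/-- The length of epoch `m + 1` before rounding. -/
noncomputable def realLen (K T L m : ℕ) : ℝ := K * lam K T L (m + 1) * base T L ^ (2 * m)

lemma realLen_le_epochLen (m : ℕ) : realLen K T L m ≤ epochLen K T L (m + 1) :=
  Nat.le_ceil _

lemma epochEnd_mono : Monotone (epochEnd K T L) :=
  monotone_nat_of_le_succ fun m => by rw [epochEnd]; omega

variable [NeZero K]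

lemma one_le_cast_arms (K : ℕ) [NeZero K] : (1 : ℝ) ≤ K := by
  exact_mod_cast Nat.one_le_iff_ne_zero.2 (NeZero.ne K)

lemma log_cast_arms_nonneg (K : ℕ) [NeZero K] : 0 ≤ Real.log K :=
  Real.log_nonneg (one_le_cast_arms K)

lemma log_base_mul : Real.log (base T L * K) = Real.log (base T L) + Real.log K :=
  Real.log_mul base_pos.ne' (by have := one_le_cast_arms K; positivity)

lemma log_base_mul_pos : 0 < Real.log (base T L * K) := by
  rw [log_base_mul]
  have := log_base_pos (T := T) (L := L)
  have := log_cast_arms_nonneg K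
  linarith

lemma zeta_pos (m : ℕ) : 0 < zeta K T L m := by
  have := base_pos (T := T) (L := L)
  have := log_base_mul_pos (K := K) (T := T) (L := L)
  unfold zeta
  positivity

lemma delta_pos (m : ℕ) : 0 < delta K T L m := by
  have := zeta_pos (K := K) (T := T) (L := L) m
  have := one_le_cast_arms K
  unfold delta
  positivity

lemma log_four_div_beta (m : ℕ) : Real.log (4 / beta K T L m) = logTerm K T L m := by
  have := delta_pos (K := K) (T := T) (L := L) m
  have := one_le_cast_arms K
  unfold logTerm beta
  congr 1
  field_simp

lemma logTerm_eq (m : ℕ) :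
    logTerm K T L m = Real.log 4 + 2 * Real.log K + Real.log ((m : ℝ) + 4) +
      2 * ((m : ℝ) + 4) * Real.log (base T L) + Real.log (Real.log (base T L * K)) := by
  have h1 := one_le_cast_arms K
  have h2 := base_pos (T := T) (L := L)
  have h3 := log_base_mul_pos (K := K) (T := T) (L := L)
  have h4 : (4 * K / delta K T L m : ℝ) = 4 * (K ^ 2 * (((m : ℝ) + 4) *
      base T L ^ (2 * (m + 4)) * Real.log (base T L * K))) := by
    unfold delta zeta
    field_simp
  have hK : (K : ℝ) ≠ 0 := by positivity
  rw [logTerm, h4, Real.log_mul (by norm_num) (by positivity), Real.log_mul (by positivity)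
    (by positivity), Real.log_mul (by positivity) (by positivity), Real.log_mul (by positivity)
    (by positivity), Real.log_pow, Real.log_pow]
  push_cast
  ring

/-- The order of magnitude `ln K + (m + 4) ln a` of `ln (4 K / δ_m)`. -/
noncomputable def logScale (K T L m : ℕ) : ℝ := Real.log K + ((m : ℝ) + 4) * Real.log (base T L)

lemma logScale_pos (m : ℕ) : 0 < logScale K T L m := by
  have := log_cast_arms_nonneg K
  have := log_base_pos (T := T) (L := L)
  unfold logScale
  positivity

lemma two_mul_logScale_le (m : ℕ) : 2 * logScale K T L m ≤ logTerm K T L m := by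
  rw [logTerm_eq, logScale]
  have h2 : (0.69 : ℝ) < Real.log 2 := by linarith [Real.log_two_gt_d9]
  have h3 : (0.69 : ℝ) < Real.log (base T L * K) := by
    rw [log_base_mul]
    have := log_two_le_log_base (T := T) (L := L)
    have := log_cast_arms_nonneg K
    linarith
  have h4 : Real.log 4 + Real.log (Real.log (base T L * K)) ≥ 0 := by
    rw [← Real.log_mul (by norm_num) (by linarith)]
    exact Real.log_nonneg (by linarith)
  have h5 : 0 ≤ Real.log ((m : ℝ) + 4) := Real.log_nonneg (by have := m.cast_nonneg (α := ℝ); linarith)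
  linarith

lemma logTerm_le (m : ℕ) : logTerm K T L m ≤ 4 * logScale K T L m := by
  rw [logTerm_eq, logScale]
  have ha := log_two_le_log_base (T := T) (L := L)
  have ha' := log_base_pos (T := T) (L := L)
  have hK := log_cast_arms_nonneg K
  have h1 : Real.log 4 = 2 * Real.log 2 := by
    rw [show (4 : ℝ) = 2 ^ 2 by norm_num, Real.log_pow]; norm_num
  have h2 : Real.log ((m : ℝ) + 4) ≤ ((m : ℝ) + 4) * Real.log (base T L) := by
    have : ((m : ℝ) + 4) ≤ 2 ^ (m + 4) := by
      exact_mod_cast (Nat.lt_two_pow_self (n := m + 4)).le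
    calc Real.log ((m : ℝ) + 4) ≤ Real.log (2 ^ (m + 4)) := Real.log_le_log (by positivity) this
      _ = ((m : ℝ) + 4) * Real.log 2 := by rw [Real.log_pow]; push_cast; ring
      _ ≤ _ := by gcongr
  have h3 : Real.log (Real.log (base T L * K)) ≤ Real.log (base T L) + Real.log K := by
    rw [← log_base_mul]
    have := Real.log_le_sub_one_of_pos (log_base_mul_pos (K := K) (T := T) (L := L))
    linarith
  have h4 : 0 ≤ (m : ℝ) * Real.log (base T L) := by positivity
  nlinarith

lemma logTerm_pos (m : ℕ) : 0 < logTerm K T L m := by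
  have := two_mul_logScale_le (K := K) (T := T) (L := L) m
  have := logScale_pos (K := K) (T := T) (L := L) m
  linarith

lemma one_le_logTerm (m : ℕ) : 1 ≤ logTerm K T L m := by
  have h := two_mul_logScale_le (K := K) (T := T) (L := L) m
  have ha := log_two_le_log_base (T := T) (L := L)
  have h2 : (0.69 : ℝ) < Real.log 2 := by linarith [Real.log_two_gt_d9]
  have hK := log_cast_arms_nonneg K
  have h4 : 0 ≤ (m : ℝ) * Real.log (base T L) := by
    have := log_base_pos (T := T) (L := L); positivity
  unfold logScale at h
  nlinarith

lemma logTerm_succ_le (m : ℕ) : logTerm K T L (m + 1) ≤ 3 / 2 * logTerm K T L m := by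
  have h1 := two_mul_logScale_le (K := K) (T := T) (L := L) m
  have ha := log_two_le_log_base (T := T) (L := L)
  have ha' := log_base_pos (T := T) (L := L)
  have hK := log_cast_arms_nonneg K
  have h2 : Real.log (((m + 1 : ℕ) : ℝ) + 4) ≤ Real.log ((m : ℝ) + 4) + Real.log (base T L) := by
    rw [← Real.log_mul (by positivity) base_pos.ne']
    apply Real.log_le_log (by positivity)
    push_cast
    have := two_le_base (T := T) (L := L)
    have := m.cast_nonneg (α := ℝ)
    nlinarith
  have h3 : logTerm K T L (m + 1) ≤ logTerm K T L m + 3 * Real.log (base T L) := by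
    rw [logTerm_eq, logTerm_eq]
    push_cast at h2 ⊢
    linarith
  have h4 : 0 ≤ (m : ℝ) * Real.log (base T L) := by positivity
  unfold logScale at h1
  nlinarith

lemma lam_pos (m : ℕ) : 0 < lam K T L m := by
  rw [lam_eq]
  have := logTerm_pos (K := K) (T := T) (L := L) m
  have := base_pos (T := T) (L := L)
  positivity

lemma one_le_lam (m : ℕ) : 1 ≤ lam K T L m := by
  rw [lam_eq]
  exact one_le_mul_of_one_le_of_one_le (one_le_pow₀ one_le_base) (one_le_logTerm m)

lemma one_le_realLen (m : ℕ) : 1 ≤ realLen K T L m :=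
  one_le_mul_of_one_le_of_one_le
    (one_le_mul_of_one_le_of_one_le (one_le_cast_arms K) (one_le_lam _)) (one_le_pow₀ one_le_base)

lemma epochLen_le_add_one (m : ℕ) : (epochLen K T L (m + 1) : ℝ) ≤ realLen K T L m + 1 :=
  (Nat.ceil_lt_add_one (zero_le_one.trans (one_le_realLen (K := K) m))).le

lemma epochLen_le_two_mul (m : ℕ) : (epochLen K T L (m + 1) : ℝ) ≤ 2 * realLen K T L m := by
  have := epochLen_le_add_one (K := K) (T := T) (L := L) m
  have := one_le_realLen (K := K) (T := T) (L := L) m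
  linarith

lemma epochLen_pos (m : ℕ) : (0 : ℝ) < epochLen K T L (m + 1) :=
  zero_lt_one.trans_le ((one_le_realLen m).trans (realLen_le_epochLen m))

lemma realLen_succ_le (m : ℕ) :
    realLen K T L (m + 1) ≤ 3 / 2 * base T L ^ 2 * realLen K T L m := by
  have h := logTerm_succ_le (K := K) (T := T) (L := L) (m + 1)
  have ha := base_pos (T := T) (L := L)
  have hK := one_le_cast_arms K
  unfold realLen
  rw [lam_eq, lam_eq]
  calc (K : ℝ) * (base T L ^ 8 * logTerm K T L (m + 1 + 1)) * base T L ^ (2 * (m + 1))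
      ≤ (K : ℝ) * (base T L ^ 8 * (3 / 2 * logTerm K T L (m + 1))) * base T L ^ (2 * (m + 1)) := by
        gcongr
    _ = _ := by ring

lemma epochLen_mul_delta_le (m : ℕ) :
    base T L ^ 2 * (epochLen K T L (m + 1) * delta K T L (m + 1)) ≤ 8 := by
  have h1 := epochLen_le_two_mul (K := K) (T := T) (L := L) m
  have h2 := logTerm_le (K := K) (T := T) (L := L) (m + 1)
  have h3 := log_base_mul_pos (K := K) (T := T) (L := L)
  have ha := base_pos (T := T) (L := L)
  have hK := one_le_cast_arms K
  have hK0 := log_cast_arms_nonneg K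
  have hd := delta_pos (K := K) (T := T) (L := L) (m + 1)
  have h4 : logScale K T L (m + 1) ≤ (((m + 1 : ℕ) : ℝ) + 4) * Real.log (base T L * K) := by
    rw [log_base_mul, logScale, mul_add]
    have : 0 ≤ (((m + 1 : ℕ) : ℝ) + 3) * Real.log K := by positivity
    linarith
  calc base T L ^ 2 * (epochLen K T L (m + 1) * delta K T L (m + 1))
      ≤ base T L ^ 2 * (2 * realLen K T L m * delta K T L (m + 1)) := by gcongr
    _ = 2 * logTerm K T L (m + 1) / ((((m + 1 : ℕ) : ℝ) + 4) * Real.log (base T L * K)) := by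
        unfold realLen delta zeta
        rw [lam_eq]
        field_simp
        ring
    _ ≤ 8 := by
        rw [div_le_iff₀ (by positivity)]
        linarith

lemma horizon_le_epochEnd (hL : 1 ≤ L) : T ≤ epochEnd K T L L := by
  obtain ⟨l, rfl⟩ := Nat.exists_eq_add_of_le' hL
  suffices h : (T : ℝ) ≤ epochLen K T (l + 1) (l + 1) by
    rw [epochEnd]
    have : T ≤ epochLen K T (l + 1) (l + 1) := by exact_mod_cast h
    omega
  refine le_trans ?_ (realLen_le_epochLen l)
  unfold realLen
  rw [lam_eq]
  have h1 : (T : ℝ) ≤ base T (l + 1) ^ (2 * (l + 4)) := by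
    have h2 : ((T : ℝ) ^ (1 / (2 * (((l + 1 : ℕ) : ℝ) + 3)))) ^ (2 * (l + 4)) = T := by
      rw [← Real.rpow_natCast, ← Real.rpow_mul (by positivity)]
      have : 1 / (2 * (((l + 1 : ℕ) : ℝ) + 3)) * ((2 * (l + 4) : ℕ) : ℝ) = 1 := by
        push_cast
        field_simp
        ring
      rw [this, Real.rpow_one]
    calc (T : ℝ) = _ := h2.symm
      _ ≤ _ := by
        gcongr
        exact le_max_left _ _
  have hb := base_pos (T := T) (L := l + 1)
  calc (T : ℝ) ≤ base T (l + 1) ^ (2 * (l + 4)) := h1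
    _ = 1 * (base T (l + 1) ^ 8 * 1) * base T (l + 1) ^ (2 * l) := by ring
    _ ≤ _ := by
        gcongr
        · exact one_le_cast_arms K
        · exact one_le_logTerm _

end Parameters

section Estimates

variable {K T L : ℕ} [NeZero K]

/-- The confidence radius `√(4 ln (4 / β_m) / ñ_k^m)`. -/
noncomputable def radius (T L m : ℕ) (e : Estimates K) (k : Fin K) : ℝ :=
  √(4 * logTerm K T L m / pulls T L m e k)

/-- The sum of the observed rewards of arm `k` in epoch `m + 1`. -/
noncomputable def epochSum (T L : ℕ) (arm : ℕ → Fin K) (obs : ℕ → ℝ) (m : ℕ) (k : Fin K) : ℝ :=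
  ∑ t ∈ Finset.Ioc (epochEnd K T L m) (epochEnd K T L (m + 1)), if arm t = k then obs t else 0

variable {arm : ℕ → Fin K} {obs : ℕ → ℝ}

lemma estimates_succ_reward (m : ℕ) (k : Fin K) :
    (estimates T L arm obs (m + 1)).reward k =
      min (epochSum T L arm obs m k / pulls T L (m + 1) (estimates T L arm obs m) k) 1 := rfl

lemma estimates_succ_gap (m : ℕ) (k : Fin K) :
    (estimates T L arm obs (m + 1)).gap k = max ((base T L)⁻¹ ^ (m + 1))
      ((⨆ j, ((estimates T L arm obs (m + 1)).reward j -
        radius T L (m + 1) (estimates T L arm obs m) j)) -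
        (estimates T L arm obs (m + 1)).reward k) := by
  simp only [radius, ← log_four_div_beta]
  rfl

lemma le_estimates_gap (m : ℕ) (k : Fin K) :
    (base T L)⁻¹ ^ m ≤ (estimates T L arm obs m).gap k := by
  cases m with
  | zero => simp [estimates]
  | succ m => rw [estimates_succ_gap]; exact le_max_left _ _

lemma estimates_gap_pos (m : ℕ) (k : Fin K) : 0 < (estimates T L arm obs m).gap k :=
  lt_of_lt_of_le (pow_pos (inv_pos.2 base_pos) m) (le_estimates_gap m k)

lemma basePulls_le (m : ℕ) (k : Fin K) :
    basePulls T L (m + 1) (estimates T L arm obs m) k ≤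
      lam K T L (m + 1) * base T L ^ (2 * m) := by
  have h := le_estimates_gap (T := T) (L := L) (arm := arm) (obs := obs) m k
  have hb := base_pos (T := T) (L := L)
  have hl := lam_pos (K := K) (T := T) (L := L) (m + 1)
  unfold basePulls
  calc lam K T L (m + 1) / (estimates T L arm obs m).gap k ^ 2
      ≤ lam K T L (m + 1) / ((base T L)⁻¹ ^ m) ^ 2 := by gcongr
    _ = _ := by
      rw [inv_pow, inv_pow, div_inv_eq_mul, ← pow_mul, mul_comm m 2]

lemma basePulls_pos (m : ℕ) (k : Fin K) :
    0 < basePulls T L (m + 1) (estimates T L arm obs m) k :=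
  div_pos (lam_pos _) (pow_pos (estimates_gap_pos m k) 2)

lemma pulls_eq_of_ne {m : ℕ} {e : Estimates K} {k : Fin K} (h : k ≠ bestArm e.reward) :
    pulls T L m e k = basePulls T L m e k := if_neg h

lemma basePulls_le_pulls (m : ℕ) (k : Fin K) :
    basePulls T L (m + 1) (estimates T L arm obs m) k ≤
      pulls T L (m + 1) (estimates T L arm obs m) k := by
  unfold pulls
  split_ifs with h
  · have h1 : ∑ j, basePulls T L (m + 1) (estimates T L arm obs m) j ≤ realLen K T L m := by
      calc ∑ j, basePulls T L (m + 1) (estimates T L arm obs m) j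
          ≤ ∑ _j : Fin K, lam K T L (m + 1) * base T L ^ (2 * m) :=
            Finset.sum_le_sum fun j _ => basePulls_le m j
        _ = _ := by simp [realLen, mul_assoc]
    rw [← Finset.add_sum_erase _ _ (Finset.mem_univ k)] at h1
    have := realLen_le_epochLen (K := K) (T := T) (L := L) m
    linarith
  · exact le_rfl

lemma pulls_pos (m : ℕ) (k : Fin K) : 0 < pulls T L (m + 1) (estimates T L arm obs m) k :=
  (basePulls_pos m k).trans_le (basePulls_le_pulls m k)

lemma sum_pulls (m : ℕ) (e : Estimates K) : ∑ k, pulls T L m e k = epochLen K T L m := by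
  rw [← Finset.add_sum_erase _ _ (Finset.mem_univ (bestArm e.reward))]
  have : ∑ k ∈ Finset.univ.erase (bestArm e.reward), pulls T L m e k =
      ∑ k ∈ Finset.univ.erase (bestArm e.reward), basePulls T L m e k :=
    Finset.sum_congr rfl fun k hk => pulls_eq_of_ne (Finset.ne_of_mem_erase hk)
  rw [this, pulls, if_pos rfl]
  ring

lemma pulls_le_epochLen (m : ℕ) (k : Fin K) :
    pulls T L (m + 1) (estimates T L arm obs m) k ≤ epochLen K T L (m + 1) := by
  rw [← sum_pulls (m + 1) (estimates T L arm obs m)]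
  exact Finset.single_le_sum (f := pulls T L (m + 1) (estimates T L arm obs m))
    (fun j _ => (pulls_pos m j).le) (Finset.mem_univ k)

lemma estimates_reward_mem (hobs : ∀ t, 0 ≤ obs t) (m : ℕ) (k : Fin K) :
    (estimates T L arm obs m).reward k ∈ Set.Icc (0 : ℝ) 1 := by
  cases m with
  | zero => simp [estimates]
  | succ m =>
    rw [estimates_succ_reward]
    refine ⟨le_min (div_nonneg (Finset.sum_nonneg fun t _ => ?_) (pulls_pos m k).le) zero_le_one,
      min_le_right _ _⟩
    split_ifs
    exacts [hobs t, le_rfl]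

lemma radius_nonneg (m : ℕ) (e : Estimates K) (k : Fin K) : 0 ≤ radius T L m e k :=
  Real.sqrt_nonneg _

lemma estimates_gap_le_one (hobs : ∀ t, 0 ≤ obs t) (m : ℕ) (k : Fin K) :
    (estimates T L arm obs m).gap k ≤ 1 := by
  cases m with
  | zero => simp [estimates]
  | succ m =>
    rw [estimates_succ_gap]
    refine max_le (pow_le_one₀ (inv_nonneg.2 base_pos.le) (inv_le_one_of_one_le₀ one_le_base)) ?_
    have h1 := (estimates_reward_mem (T := T) (L := L) (arm := arm) hobs (m + 1) k).1
    have h2 : (⨆ j, ((estimates T L arm obs (m + 1)).reward j -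
        radius T L (m + 1) (estimates T L arm obs m) j)) ≤ 1 := ciSup_le fun j => by
      have h3 := (estimates_reward_mem (T := T) (L := L) (arm := arm) hobs (m + 1) j).2
      have h4 := radius_nonneg (T := T) (L := L) (m + 1) (estimates T L arm obs m) j
      linarith
    linarith

lemma lam_le_pulls (hobs : ∀ t, 0 ≤ obs t) (m : ℕ) (k : Fin K) :
    lam K T L (m + 1) ≤ pulls T L (m + 1) (estimates T L arm obs m) k := by
  refine le_trans ?_ (basePulls_le_pulls m k)
  unfold basePulls
  have h1 := estimates_gap_pos (T := T) (L := L) (arm := arm) (obs := obs) m k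
  rw [le_div_iff₀ (by positivity)]
  exact mul_le_of_le_one_right (lam_pos _).le
    (pow_le_one₀ h1.le (estimates_gap_le_one hobs m k))

lemma radius_le (m : ℕ) (k : Fin K) :
    radius T L (m + 1) (estimates T L arm obs m) k ≤
      2 / base T L ^ 4 * (estimates T L arm obs m).gap k := by
  have hg := estimates_gap_pos (T := T) (L := L) (arm := arm) (obs := obs) m k
  have hb := base_pos (T := T) (L := L)
  have hx := logTerm_pos (K := K) (T := T) (L := L) (m + 1)
  have hp := basePulls_pos (T := T) (L := L) (arm := arm) (obs := obs) m k
  unfold radius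
  apply Real.sqrt_le_iff.2 ⟨by positivity, ?_⟩
  calc 4 * logTerm K T L (m + 1) / pulls T L (m + 1) (estimates T L arm obs m) k
      ≤ 4 * logTerm K T L (m + 1) / basePulls T L (m + 1) (estimates T L arm obs m) k := by
        gcongr
        exact basePulls_le_pulls m k
    _ = _ := by
        unfold basePulls
        rw [lam_eq]
        field_simp
        norm_num

lemma reward_le_bestArm (r : Fin K → ℝ) (j : Fin K) : r j ≤ r (bestArm r) := by
  have := Finset.min'_mem _ (exists_maximizer r)
  exact (Finset.mem_filter.1 this).2 j

end Estimates

section Deterministic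

variable {K T L : ℕ} [NeZero K] {arm : ℕ → Fin K} {obs : ℕ → ℝ} {μ : Fin K → ℝ} {c : ℕ → ℝ} {M : ℕ}

/-- The discounted accumulated estimation error `∑_{s ≤ m} (2 a⁻⁴)^(m - s) c_s`. -/
noncomputable def accError (T L : ℕ) (c : ℕ → ℝ) : ℕ → ℝ
  | 0 => 0
  | m + 1 => 2 / base T L ^ 4 * accError T L c m + c (m + 1)

lemma accError_nonneg (hc : ∀ m, 0 ≤ c m) (m : ℕ) : 0 ≤ accError T L c m := by
  have := base_pos (T := T) (L := L)
  induction m with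
  | zero => exact le_rfl
  | succ m ih => unfold accError; have := hc (m + 1); positivity

/-- In every epoch `m` with `1 ≤ m < M`, each estimated reward is within its confidence radius
plus `c m` of the true mean. -/
def Accurate (T L : ℕ) (arm : ℕ → Fin K) (obs : ℕ → ℝ) (μ : Fin K → ℝ) (c : ℕ → ℝ) (M : ℕ) :
    Prop :=
  ∀ m, m + 1 < M → ∀ k, |(estimates T L arm obs (m + 1)).reward k - μ k| ≤
    radius T L (m + 1) (estimates T L arm obs m) k + c (m + 1)

lemma ratio_le : 2 / base T L ^ 4 ≤ 1 / 8 := by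
  have h := two_le_base (T := T) (L := L)
  have : (2 : ℝ) ^ 4 ≤ base T L ^ 4 := by gcongr
  rw [div_le_div_iff₀ (by linarith) (by norm_num)]
  linarith

lemma ratio_mul_inv_pow_le (m : ℕ) :
    2 / base T L ^ 4 * (base T L)⁻¹ ^ m ≤ 1 / 4 * (base T L)⁻¹ ^ (m + 1) := by
  have h := two_le_base (T := T) (L := L)
  have hb := base_pos (T := T) (L := L)
  have h3 : (2 : ℝ) ^ 3 ≤ base T L ^ 3 := by gcongr
  rw [pow_succ _ m, mul_comm ((base T L)⁻¹ ^ m), ← mul_assoc]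
  gcongr
  rw [div_le_iff₀ (by positivity)]
  calc (2 : ℝ) ≤ 1 / 4 * base T L ^ 3 := by linarith
    _ = _ := by field_simp

lemma estimates_gap_le (hc : ∀ m, 0 ≤ c m) (hacc : Accurate T L arm obs μ c M)
    (μmax : ℝ) (hmax : ∀ j, μ j ≤ μmax) (m : ℕ) (hm : m < M) (k : Fin K) :
    (estimates T L arm obs m).gap k ≤
      8 / 7 * (μmax - μ k) + 2 * accError T L c m + (base T L)⁻¹ ^ m := by
  induction m with
  | zero =>
    have := hmax k
    simp only [estimates, accError, pow_zero]
    linarith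
  | succ m ih =>
    have ih := ih (by omega)
    have hq := ratio_le (T := T) (L := L)
    have hq2 := ratio_mul_inv_pow_le (T := T) (L := L) m
    have hb := base_pos (T := T) (L := L)
    have hinv : 0 < (base T L)⁻¹ ^ (m + 1) := by positivity
    have hk := hmax k
    have hrho := accError_nonneg (T := T) (L := L) hc (m + 1)
    rw [estimates_succ_gap]
    refine max_le (by linarith) ?_
    have h1 : (⨆ j, ((estimates T L arm obs (m + 1)).reward j -
        radius T L (m + 1) (estimates T L arm obs m) j)) ≤ μmax + c (m + 1) :=
      ciSup_le fun j => by
        have := (abs_le.1 (hacc m hm j)).2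
        have := hmax j
        linarith
    have h2 := (abs_le.1 (hacc m hm k)).1
    have h3 := radius_le (T := T) (L := L) (arm := arm) (obs := obs) m k
    set q := 2 / base T L ^ 4 with hqdef
    have hq0 : 0 ≤ q := by positivity
    have h4 : q * (estimates T L arm obs m).gap k ≤
        q * (8 / 7 * (μmax - μ k) + 2 * accError T L c m + (base T L)⁻¹ ^ m) := by gcongr
    have h5 : q * (8 / 7 * (μmax - μ k)) ≤ 1 / 8 * (8 / 7 * (μmax - μ k)) := by
      gcongr
    have h6 : accError T L c (m + 1) = q * accError T L c m + c (m + 1) := rfl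
    rw [h6]
    linarith

lemma gap_le_estimates_gap (hc : ∀ m, 0 ≤ c m) (hacc : Accurate T L arm obs μ c M)
    (μmax : ℝ) (hmax : ∀ j, μ j ≤ μmax) (hle : μmax ≤ 1) (hμ : ∀ j, 0 ≤ μ j) (o : Fin K)
    (ho : μ o = μmax) (m : ℕ) (hm : m < M) (k : Fin K) :
    μmax - μ k ≤ 3 * (estimates T L arm obs m).gap k + 7 * accError T L c m := by
  cases m with
  | zero =>
    have := hμ k
    simp only [estimates, accError]
    linarith
  | succ m =>
    have hq := ratio_le (T := T) (L := L)
    have hq2 := ratio_mul_inv_pow_le (T := T) (L := L) m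
    have hb := base_pos (T := T) (L := L)
    have hk := hmax k
    have hgap := estimates_gap_pos (T := T) (L := L) (arm := arm) (obs := obs) (m + 1) k
    have hrho := accError_nonneg (T := T) (L := L) hc m
    have hcm := hc (m + 1)
    have h0 : (base T L)⁻¹ ^ (m + 1) ≤ (estimates T L arm obs (m + 1)).gap k :=
      le_estimates_gap (m + 1) k
    have h1 : (⨆ j, ((estimates T L arm obs (m + 1)).reward j -
        radius T L (m + 1) (estimates T L arm obs m) j)) -
        (estimates T L arm obs (m + 1)).reward k ≤ (estimates T L arm obs (m + 1)).gap k := by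
      rw [estimates_succ_gap]; exact le_max_right _ _
    have h2 := le_ciSup (f := fun j => (estimates T L arm obs (m + 1)).reward j -
        radius T L (m + 1) (estimates T L arm obs m) j) (Set.finite_range _).bddAbove o
    have h3 := (abs_le.1 (hacc m hm o)).1
    have h4 := (abs_le.1 (hacc m hm k)).2
    have h5 := radius_le (T := T) (L := L) (arm := arm) (obs := obs) m k
    have h6 := radius_le (T := T) (L := L) (arm := arm) (obs := obs) m o
    have h7 := estimates_gap_le hc hacc μmax hmax m (by omega) k
    have h8 := estimates_gap_le hc hacc μmax hmax m (by omega) o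
    set q := 2 / base T L ^ 4 with hqdef
    have hq0 : 0 ≤ q := by positivity
    have h9 := mul_le_mul_of_nonneg_left h7 hq0
    have h10 := mul_le_mul_of_nonneg_left h8 hq0
    have h11 : q * (8 / 7 * (μmax - μ k)) ≤ 1 / 8 * (8 / 7 * (μmax - μ k)) := by
      gcongr
    have h12 : accError T L c (m + 1) = q * accError T L c m + c (m + 1) := rfl
    have h13 : 0 ≤ q * accError T L c m := by positivity
    rw [h12]
    rw [ho] at h3 h10
    simp only [sub_self, mul_zero, zero_add] at h10
    linarith

lemma gap_bestArm_le (hc : ∀ m, 0 ≤ c m) (hacc : Accurate T L arm obs μ c M)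
    (μmax : ℝ) (hmax : ∀ j, μ j ≤ μmax) (o : Fin K)
    (ho : μ o = μmax) (m : ℕ) (hm : m + 1 < M) (k : Fin K)
    (hk : k = bestArm (estimates T L arm obs (m + 1)).reward) :
    μmax - μ k ≤ 5 * accError T L c (m + 1) + 3 / 5 * (base T L)⁻¹ ^ (m + 1) := by
  have hq := ratio_le (T := T) (L := L)
  have hq2 := ratio_mul_inv_pow_le (T := T) (L := L) m
  have hb := base_pos (T := T) (L := L)
  have hinv : 0 < (base T L)⁻¹ ^ (m + 1) := by positivity
  have hk0 := hmax k
  have hrho := accError_nonneg (T := T) (L := L) hc m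
  have hcm := hc (m + 1)
  have h1 := reward_le_bestArm (estimates T L arm obs (m + 1)).reward o
  rw [← hk] at h1
  have h3 := (abs_le.1 (hacc m hm o)).1
  have h4 := (abs_le.1 (hacc m hm k)).2
  have h5 := radius_le (T := T) (L := L) (arm := arm) (obs := obs) m k
  have h6 := radius_le (T := T) (L := L) (arm := arm) (obs := obs) m o
  have h7 := estimates_gap_le hc hacc μmax hmax m (by omega) k
  have h8 := estimates_gap_le hc hacc μmax hmax m (by omega) o
  set q := 2 / base T L ^ 4 with hqdef
  have hq0 : 0 ≤ q := by positivity
  have h9 := mul_le_mul_of_nonneg_left h7 hq0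
  have h10 := mul_le_mul_of_nonneg_left h8 hq0
  have h11 : q * (8 / 7 * (μmax - μ k)) ≤ 1 / 8 * (8 / 7 * (μmax - μ k)) := by
    gcongr
  have h12 : accError T L c (m + 1) = q * accError T L c m + c (m + 1) := rfl
  have h13 : 0 ≤ q * accError T L c m := by positivity
  rw [h12]
  rw [ho] at h3 h10
  simp only [sub_self, mul_zero, zero_add] at h10
  linarith

/-- The regret of the pulls that are not left over to the apparently best arm. -/
lemma gap_mul_basePulls_le (hc : ∀ m, 0 ≤ c m) (hacc : Accurate T L arm obs μ c M)
    (μmax : ℝ) (hmax : ∀ j, μ j ≤ μmax) (hle : μmax ≤ 1) (hμ : ∀ j, 0 ≤ μ j) (o : Fin K)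
    (ho : μ o = μmax) (m : ℕ) (hm : m < M) (k : Fin K) :
    (μmax - μ k) * basePulls T L (m + 1) (estimates T L arm obs m) k ≤
      36 * lam K T L (m + 1) / (μmax - μ k) +
        14 * accError T L c m * (lam K T L (m + 1) * base T L ^ (2 * m)) := by
  have h1 := gap_le_estimates_gap hc hacc μmax hmax hle hμ o ho m hm k
  have h2 := basePulls_le (T := T) (L := L) (arm := arm) (obs := obs) m k
  have hp := basePulls_pos (T := T) (L := L) (arm := arm) (obs := obs) m k
  have hg := estimates_gap_pos (T := T) (L := L) (arm := arm) (obs := obs) m k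
  have hl := lam_pos (K := K) (T := T) (L := L) (m + 1)
  have hb := base_pos (T := T) (L := L)
  have hrho := accError_nonneg (T := T) (L := L) hc m
  have hd : 0 ≤ μmax - μ k := sub_nonneg.2 (hmax k)
  set d := μmax - μ k
  rcases le_or_gt d (14 * accError T L c m) with h | h
  · have h3 : d * basePulls T L (m + 1) (estimates T L arm obs m) k ≤
        14 * accError T L c m * (lam K T L (m + 1) * base T L ^ (2 * m)) := by gcongr
    have h4 : 0 ≤ 36 * lam K T L (m + 1) / d := by positivity
    linarith
  · have hd0 : 0 < d := by linarith
    have h3 : d ≤ 6 * (estimates T L arm obs m).gap k := by linarith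
    have h4 : d * basePulls T L (m + 1) (estimates T L arm obs m) k ≤
        36 * lam K T L (m + 1) / d := by
      unfold basePulls
      rw [← mul_div_assoc, div_le_div_iff₀ (by positivity) hd0]
      have h5 : d ^ 2 ≤ (6 * (estimates T L arm obs m).gap k) ^ 2 := by gcongr
      nlinarith
    have h5 : 0 ≤ 14 * accError T L c m * (lam K T L (m + 1) * base T L ^ (2 * m)) := by
      positivity
    linarith

lemma sum_gap_mul_pulls_le (hc : ∀ m, 0 ≤ c m) (hacc : Accurate T L arm obs μ c M)
    (μmax : ℝ) (hmax : ∀ j, μ j ≤ μmax) (hle : μmax ≤ 1) (hμ : ∀ j, 0 ≤ μ j) (o : Fin K)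
    (ho : μ o = μmax) (D : ℝ) (hD : 0 < D) (hDle : ∀ k, 0 < μmax - μ k → D ≤ μmax - μ k)
    (m : ℕ) (hm : m < M) :
    ∑ k, (μmax - μ k) * pulls T L (m + 1) (estimates T L arm obs m) k ≤
      38 * lam K T L (m + 1) * ∑ k, 1 / (μmax - μ k) +
      (if 1 ≤ m ∧ base T L ^ m * D ≤ 1 then 2 * K * lam K T L (m + 1) / D else 0) +
      42 * (accError T L c m * realLen K T L m) := by
  have hl := lam_pos (K := K) (T := T) (L := L) (m + 1)
  have hb := base_pos (T := T) (L := L)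
  have hrho := accError_nonneg (T := T) (L := L) hc m
  have hN := epochLen_le_two_mul (K := K) (T := T) (L := L) m
  have hr1 := one_le_realLen (K := K) (T := T) (L := L) m
  have hK := one_le_cast_arms K
  obtain ⟨b, hbest⟩ : ∃ b, b = bestArm (estimates T L arm obs m).reward := ⟨_, rfl⟩
  have hd : ∀ k, 0 ≤ μmax - μ k := fun k => sub_nonneg.2 (hmax k)
  have hinv : ∀ k, 0 ≤ 1 / (μmax - μ k) := fun k => one_div_nonneg.2 (hd k)
  have hbase : ∑ k ∈ Finset.univ.erase b,
      (μmax - μ k) * pulls T L (m + 1) (estimates T L arm obs m) k ≤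
      36 * lam K T L (m + 1) * ∑ k, 1 / (μmax - μ k) +
        14 * (accError T L c m * realLen K T L m) := by
    calc _ = ∑ k ∈ Finset.univ.erase b,
          (μmax - μ k) * basePulls T L (m + 1) (estimates T L arm obs m) k :=
          Finset.sum_congr rfl fun k hk => by
            rw [pulls_eq_of_ne (hbest ▸ Finset.ne_of_mem_erase hk)]
      _ ≤ ∑ k, (μmax - μ k) * basePulls T L (m + 1) (estimates T L arm obs m) k :=
          Finset.sum_le_sum_of_subset_of_nonneg (Finset.erase_subset _ _)
            fun k _ _ => mul_nonneg (hd k) (basePulls_pos m k).le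
      _ ≤ ∑ k, (36 * lam K T L (m + 1) * (1 / (μmax - μ k)) +
            14 * accError T L c m * (lam K T L (m + 1) * base T L ^ (2 * m))) :=
          Finset.sum_le_sum fun k _ => by
            rw [mul_one_div]
            exact gap_mul_basePulls_le hc hacc μmax hmax hle hμ o ho m hm k
      _ = _ := by
          rw [Finset.sum_add_distrib, ← Finset.mul_sum]
          simp [realLen]
          ring
  have hpb := pulls_le_epochLen (T := T) (L := L) (arm := arm) (obs := obs) m b
  have hbb : (μmax - μ b) * pulls T L (m + 1) (estimates T L arm obs m) b ≤
      2 * lam K T L (m + 1) * ∑ k, 1 / (μmax - μ k) +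
      (if 1 ≤ m ∧ base T L ^ m * D ≤ 1 then 2 * K * lam K T L (m + 1) / D else 0) +
      28 * (accError T L c m * realLen K T L m) := by
    have hs : 1 / (μmax - μ b) ≤ ∑ k, 1 / (μmax - μ k) :=
      Finset.single_le_sum (f := fun k => 1 / (μmax - μ k)) (fun k _ => hinv k) (Finset.mem_univ b)
    have hs0 : 0 ≤ ∑ k, 1 / (μmax - μ k) := Finset.sum_nonneg fun k _ => hinv k
    have hi0 : 0 ≤ if 1 ≤ m ∧ base T L ^ m * D ≤ 1 then 2 * K * lam K T L (m + 1) / D else 0 := by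
      split_ifs
      · positivity
      · exact le_rfl
    have hdb := hd b
    rcases hdb.eq_or_lt with h0 | h0
    · rw [← h0, zero_mul]
      positivity
    rcases m with _ | m
    · have hp : pulls T L (0 + 1) (estimates T L arm obs 0) b ≤ 2 * lam K T L (0 + 1) := by
        have hlen := epochLen_le_add_one (K := K) (T := T) (L := L) 0
        have h1 := one_le_lam (K := K) (T := T) (L := L) (0 + 1)
        simp only [pulls, ← hbest, if_true]
        have h2 : ∑ j ∈ Finset.univ.erase b, basePulls T L (0 + 1) (estimates T L arm obs 0) j =
            ((K : ℝ) - 1) * lam K T L (0 + 1) := by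
          have h3 : 1 ≤ K := Nat.one_le_iff_ne_zero.2 (NeZero.ne K)
          simp [basePulls, estimates, Nat.cast_sub h3]
        rw [h2]
        simp only [realLen, mul_zero, pow_zero, mul_one] at hlen
        linarith
      have h1 : μmax - μ b ≤ 1 / (μmax - μ b) := by
        rw [le_div_iff₀ h0]
        have : μmax - μ b ≤ 1 := by linarith [hμ b]
        nlinarith
      have h2 : (μmax - μ b) * pulls T L (0 + 1) (estimates T L arm obs 0) b ≤
          (∑ k, 1 / (μmax - μ k)) * (2 * lam K T L (0 + 1)) :=
        mul_le_mul (h1.trans hs) hp (pulls_pos 0 b).le hs0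
      have h3 : 0 ≤ accError T L c 0 * realLen K T L 0 := by positivity
      linarith
    · have h1 := gap_bestArm_le hc hacc μmax hmax o ho m hm b hbest
      have h2 : (μmax - μ b) * pulls T L (m + 1 + 1) (estimates T L arm obs (m + 1)) b ≤
          (μmax - μ b) * (2 * realLen K T L (m + 1)) := by
        gcongr
        exact hpb.trans hN
      rcases le_or_gt (μmax - μ b) (14 * accError T L c (m + 1)) with h | h
      · have h3 : (μmax - μ b) * (2 * realLen K T L (m + 1)) ≤
            14 * accError T L c (m + 1) * (2 * realLen K T L (m + 1)) := by gcongr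
        have h4 : 0 ≤ 2 * lam K T L (m + 1 + 1) * ∑ k, 1 / (μmax - μ k) := by positivity
        linarith
      · have hpow : 0 < base T L ^ (m + 1) := by positivity
        have h3 : μmax - μ b ≤ (base T L)⁻¹ ^ (m + 1) := by
          have : 0 < (base T L)⁻¹ ^ (m + 1) := by positivity
          linarith
        have h4 : base T L ^ (m + 1) * (μmax - μ b) ≤ 1 := by
          calc base T L ^ (m + 1) * (μmax - μ b)
              ≤ base T L ^ (m + 1) * (base T L)⁻¹ ^ (m + 1) := by gcongr
            _ = 1 := by rw [inv_pow]; field_simp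
        have hDb := hDle b h0
        have h5 : base T L ^ (m + 1) * D ≤ 1 :=
          (mul_le_mul_of_nonneg_left hDb hpow.le).trans h4
        rw [if_pos ⟨by omega, h5⟩]
        have h6 : (μmax - μ b) * (2 * realLen K T L (m + 1)) ≤ 2 * K * lam K T L (m + 1 + 1) / D := by
          rw [le_div_iff₀ hD]
          have h7 : (base T L ^ (m + 1) * (μmax - μ b)) * (base T L ^ (m + 1) * D) ≤ 1 :=
            mul_le_one₀ h4 (by positivity) h5
          calc (μmax - μ b) * (2 * realLen K T L (m + 1)) * D
              = 2 * K * lam K T L (m + 1 + 1) *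
                ((base T L ^ (m + 1) * (μmax - μ b)) * (base T L ^ (m + 1) * D)) := by
                unfold realLen; ring
            _ ≤ 2 * K * lam K T L (m + 1 + 1) * 1 := by gcongr
            _ = _ := mul_one _
        have h8 : 0 ≤ 2 * lam K T L (m + 1 + 1) * ∑ k, 1 / (μmax - μ k) := by positivity
        have h9 : 0 ≤ accError T L c (m + 1) * realLen K T L (m + 1) := by positivity
        linarith
  rw [← Finset.add_sum_erase _ _ (Finset.mem_univ b)]
  linarith

lemma sum_accError_mul_realLen_le (hc : ∀ m, 0 ≤ c m) (M : ℕ) :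
    ∑ m ∈ Finset.range (M + 1), accError T L c m * realLen K T L m ≤
      6 * base T L ^ 2 * ∑ m ∈ Finset.range M, realLen K T L m * c (m + 1) := by
  have hb := base_pos (T := T) (L := L)
  have ha2 : (2 : ℝ) ^ 2 ≤ base T L ^ 2 := by gcongr; exact two_le_base
  have hstep : ∀ m, accError T L c (m + 1) * realLen K T L (m + 1) ≤
      3 / 4 * (accError T L c m * realLen K T L m) +
        3 / 2 * base T L ^ 2 * (realLen K T L m * c (m + 1)) := fun m => by
    have h1 := realLen_succ_le (K := K) (T := T) (L := L) m
    have h2 := accError_nonneg (T := T) (L := L) hc m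
    have h3 := accError_nonneg (T := T) (L := L) hc (m + 1)
    have h4 := one_le_realLen (K := K) (T := T) (L := L) m
    calc accError T L c (m + 1) * realLen K T L (m + 1)
        ≤ accError T L c (m + 1) * (3 / 2 * base T L ^ 2 * realLen K T L m) := by gcongr
      _ = 3 / base T L ^ 2 * (accError T L c m * realLen K T L m) +
          3 / 2 * base T L ^ 2 * (realLen K T L m * c (m + 1)) := by
          rw [accError]
          field_simp
      _ ≤ _ := by
          gcongr ?_ * _ + _
          rw [div_le_iff₀ (by positivity)]
          linarith
  have h0 : accError T L c 0 = 0 := rfl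
  have hsum : ∑ m ∈ Finset.range (M + 1), accError T L c m * realLen K T L m =
      ∑ m ∈ Finset.range M, accError T L c (m + 1) * realLen K T L (m + 1) := by
    rw [Finset.sum_range_succ', h0, zero_mul, add_zero]
  have hle : ∑ m ∈ Finset.range M, accError T L c (m + 1) * realLen K T L (m + 1) ≤
      3 / 4 * ∑ m ∈ Finset.range M, accError T L c m * realLen K T L m +
        3 / 2 * base T L ^ 2 * ∑ m ∈ Finset.range M, realLen K T L m * c (m + 1) := by
    rw [Finset.mul_sum, Finset.mul_sum, ← Finset.sum_add_distrib]
    exact Finset.sum_le_sum fun m _ => hstep m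
  have hlast : ∑ m ∈ Finset.range M, accError T L c m * realLen K T L m ≤
      ∑ m ∈ Finset.range (M + 1), accError T L c m * realLen K T L m := by
    rw [Finset.sum_range_succ]
    have := mul_nonneg (accError_nonneg (T := T) (L := L) hc M)
      (zero_le_one.trans (one_le_realLen (K := K) (T := T) (L := L) M))
    linarith
  linarith

lemma sum_sum_gap_mul_pulls_le (hc : ∀ m, 0 ≤ c m) (hacc : Accurate T L arm obs μ c (M + 1))
    (μmax : ℝ) (hmax : ∀ j, μ j ≤ μmax) (hle : μmax ≤ 1) (hμ : ∀ j, 0 ≤ μ j) (o : Fin K)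
    (ho : μ o = μmax) (D : ℝ) (hD : 0 < D) (hDle : ∀ k, 0 < μmax - μ k → D ≤ μmax - μ k) :
    ∑ m ∈ Finset.range (M + 1),
        ∑ k, (μmax - μ k) * pulls T L (m + 1) (estimates T L arm obs m) k ≤
      ∑ m ∈ Finset.range (M + 1), (38 * lam K T L (m + 1) * ∑ k, 1 / (μmax - μ k) +
        (if 1 ≤ m ∧ base T L ^ m * D ≤ 1 then 2 * K * lam K T L (m + 1) / D else 0)) +
      252 * base T L ^ 2 * ∑ m ∈ Finset.range M, epochLen K T L (m + 1) * c (m + 1) := by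
  have h1 := sum_accError_mul_realLen_le (K := K) (T := T) (L := L) hc M
  have h2 : ∑ m ∈ Finset.range M, realLen K T L m * c (m + 1) ≤
      ∑ m ∈ Finset.range M, epochLen K T L (m + 1) * c (m + 1) :=
    Finset.sum_le_sum fun m _ =>
      mul_le_mul_of_nonneg_right (realLen_le_epochLen m) (hc (m + 1))
  have h3 : 6 * base T L ^ 2 * ∑ m ∈ Finset.range M, realLen K T L m * c (m + 1) ≤
      6 * base T L ^ 2 * ∑ m ∈ Finset.range M, epochLen K T L (m + 1) * c (m + 1) := by
    have := base_pos (T := T) (L := L)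
    gcongr
  have h4 := Finset.sum_le_sum fun m (hm : m ∈ Finset.range (M + 1)) =>
    sum_gap_mul_pulls_le hc hacc μmax hmax hle hμ o ho D hD hDle m (Finset.mem_range.1 hm)
  rw [Finset.sum_add_distrib, ← Finset.mul_sum] at h4
  linarith

end Deterministic

section Measurability

variable {K T L : ℕ} [NeZero K] {Ω : Type*} {mΩ : MeasurableSpace Ω}

lemma estimates_congr {arm : ℕ → Fin K} {obs obs' : ℕ → ℝ} (m : ℕ)
    (h : ∀ t ∈ Finset.Icc 1 (epochEnd K T L m), obs t = obs' t) :
    estimates T L arm obs m = estimates T L arm obs' m := by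
  induction m with
  | zero => rfl
  | succ m ih =>
    have hmono : epochEnd K T L m ≤ epochEnd K T L (m + 1) := epochEnd_mono (Nat.le_succ m)
    have ih := ih fun t ht => h t (Finset.Icc_subset_Icc_right hmono ht)
    have hsum : ∀ k, (∑ t ∈ Finset.Ioc (epochEnd K T L m) (epochEnd K T L (m + 1)),
        if arm t = k then obs t else 0) =
        ∑ t ∈ Finset.Ioc (epochEnd K T L m) (epochEnd K T L (m + 1)),
          if arm t = k then obs' t else 0 := fun k =>
      Finset.sum_congr rfl fun t ht => by
        rw [Finset.mem_Ioc] at ht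
        rw [h t (Finset.mem_Icc.2 ⟨by omega, ht.2⟩)]
    simp only [estimates, ih, hsum]

lemma bestArm_eq_iff (r : Fin K → ℝ) (k : Fin K) :
    k = bestArm r ↔ (∀ j, r j ≤ r k) ∧ ∀ i, i < k → ∃ j, r i < r j := by
  constructor
  · rintro rfl
    refine ⟨reward_le_bestArm r, fun i hi => ?_⟩
    by_contra! hcon
    exact absurd (Finset.min'_le (Finset.univ.filter fun k => ∀ j, r j ≤ r k) i
      (by simpa using hcon)) (not_le.2 hi)
  · rintro ⟨h1, h2⟩
    refine le_antisymm ?_ (Finset.min'_le _ _ (by simpa using h1))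
    by_contra! hlt
    obtain ⟨j, hj⟩ := h2 _ hlt
    exact absurd (reward_le_bestArm r j) (not_le.2 hj)

lemma measurableSet_eq_bestArm {r : Ω → Fin K → ℝ} (hr : ∀ k, Measurable fun ω => r ω k)
    (k : Fin K) : MeasurableSet {ω | k = bestArm (r ω)} := by
  simp only [bestArm_eq_iff, Set.ofPred_and, Set.ofPred_forall, Set.ofPred_exists]
  exact (MeasurableSet.iInter fun j => measurableSet_le (hr j) (hr k)).inter
    (MeasurableSet.iInter fun i => MeasurableSet.iInter fun _ =>
      MeasurableSet.iUnion fun j => measurableSet_lt (hr i) (hr j))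

lemma measurable_pulls {e : Ω → Estimates K} (hr : ∀ k, Measurable fun ω => (e ω).reward k)
    (hg : ∀ k, Measurable fun ω => (e ω).gap k) (m : ℕ) (k : Fin K) :
    Measurable fun ω => pulls T L m (e ω) k := by
  have hb : ∀ k, Measurable fun ω => basePulls T L m (e ω) k := fun k =>
    measurable_const.div ((hg k).pow_const 2)
  exact Measurable.ite (measurableSet_eq_bestArm hr k)
    (measurable_const.sub (Finset.measurable_sum _ fun j _ => hb j)) (hb k)

lemma measurable_estimates {arm : ℕ → Ω → Fin K} {obs : ℕ → Ω → ℝ} (m : ℕ)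
    (harm : ∀ t ∈ Finset.Icc 1 (epochEnd K T L m), Measurable (arm t))
    (hobs : ∀ t ∈ Finset.Icc 1 (epochEnd K T L m), Measurable (obs t)) :
    (∀ k, Measurable fun ω => (estimates T L (fun s => arm s ω) (fun s => obs s ω) m).reward k) ∧
    ∀ k, Measurable fun ω => (estimates T L (fun s => arm s ω) (fun s => obs s ω) m).gap k := by
  induction m with
  | zero => exact ⟨fun k => measurable_const, fun k => measurable_const⟩
  | succ m ih =>
    have hmono : epochEnd K T L m ≤ epochEnd K T L (m + 1) := epochEnd_mono (Nat.le_succ m)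
    obtain ⟨ihr, ihg⟩ := ih (fun t ht => harm t (Finset.Icc_subset_Icc_right hmono ht))
      (fun t ht => hobs t (Finset.Icc_subset_Icc_right hmono ht))
    have hp := measurable_pulls (T := T) (L := L) ihr ihg (m + 1)
    have hr : ∀ k, Measurable fun ω =>
        (estimates T L (fun s => arm s ω) (fun s => obs s ω) (m + 1)).reward k := fun k => by
      simp only [estimates_succ_reward]
      refine Measurable.min (Measurable.div (Finset.measurable_sum _ fun t ht => ?_) (hp k))
        measurable_const
      rw [Finset.mem_Ioc] at ht
      have ht' : t ∈ Finset.Icc 1 (epochEnd K T L (m + 1)) := Finset.mem_Icc.2 ⟨by omega, ht.2⟩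
      exact Measurable.ite (harm t ht' (measurableSet_singleton k)) (hobs t ht') measurable_const
    refine ⟨hr, fun k => ?_⟩
    simp only [estimates_succ_gap]
    refine measurable_const.max (Measurable.sub (Measurable.iSup fun j => (hr j).sub ?_) (hr k))
    exact (measurable_const.div (hp j)).sqrt

end Measurability

section ExponentialMoment

lemma one_add_mul_exp_sub_one_le {x p y z d : ℝ} (hp : p ∈ Set.Icc (0 : ℝ) 1)
    (hy : y ∈ Set.Icc (0 : ℝ) 1) (hz : z ∈ Set.Icc (0 : ℝ) 1) (hd : |z - y| ≤ d) :
    1 + p * (Real.exp (x * z) - 1) ≤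
      (1 + p * y * (Real.exp x - 1)) * Real.exp ((Real.exp |x| - 1) * (p * d)) := by
  have hconv : Real.exp (x * z) - 1 ≤ z * (Real.exp x - 1) := by
    have h := convexOn_exp.2 (Set.mem_univ x) (Set.mem_univ 0) hz.1 (sub_nonneg.2 hz.2)
      (by ring)
    simp only [smul_eq_mul, mul_zero, add_zero, Real.exp_zero, mul_one] at h
    rw [mul_comm x z]
    linarith
  have hd0 : 0 ≤ d := (abs_nonneg _).trans hd
  have h1 : z * (Real.exp x - 1) ≤ y * (Real.exp x - 1) + d * |Real.exp x - 1| := by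
    have h2 : (z - y) * (Real.exp x - 1) ≤ d * |Real.exp x - 1| := by
      refine (le_abs_self _).trans ?_
      rw [abs_mul]
      gcongr
    linarith
  have hpy : p * y ≤ 1 := mul_le_one₀ hp.2 hy.1 hy.2
  have hpy0 : 0 ≤ p * y := mul_nonneg hp.1 hy.1
  have hexp := Real.exp_pos x
  set A := 1 + p * y * (Real.exp x - 1) with hA
  have hA0 : 0 ≤ A := by
    have : 0 ≤ p * y * Real.exp x := by positivity
    linarith [mul_sub (p * y) (Real.exp x) 1]
  have h3 : |Real.exp x - 1| ≤ A * (Real.exp |x| - 1) := by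
    rcases le_total 0 x with hx | hx
    · have h4 : 0 ≤ Real.exp x - 1 := by linarith [Real.add_one_le_exp x]
      rw [abs_of_nonneg hx, abs_of_nonneg h4]
      have : 1 ≤ A := by linarith [mul_nonneg hpy0 h4]
      nlinarith
    · have h4 : Real.exp x ≤ 1 := Real.exp_le_one_iff.2 hx
      rw [abs_of_nonpos hx, abs_of_nonpos (by linarith)]
      have h5 : Real.exp x ≤ A := by nlinarith
      have h6 : 0 ≤ Real.exp (-x) - 1 := by linarith [Real.one_le_exp (neg_nonneg.2 hx)]
      calc -(Real.exp x - 1) = Real.exp x * (Real.exp (-x) - 1) := by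
            rw [mul_sub, ← Real.exp_add]; simp
        _ ≤ _ := by gcongr
  have hp0 := hp.1
  calc 1 + p * (Real.exp (x * z) - 1)
      ≤ 1 + p * (y * (Real.exp x - 1) + d * |Real.exp x - 1|) := by
        gcongr
        exact hconv.trans h1
    _ = A + p * d * |Real.exp x - 1| := by rw [hA]; ring
    _ ≤ A + p * d * (A * (Real.exp |x| - 1)) := by gcongr
    _ = A * ((Real.exp |x| - 1) * (p * d) + 1) := by ring
    _ ≤ _ := by
        gcongr
        exact Real.add_one_le_exp _

lemma integrable_of_abs_le {Ω : Type*} {mΩ : MeasurableSpace Ω} {P : Measure Ω}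
    [IsFiniteMeasure P] {f : Ω → ℝ} (hf : Measurable f) {B : ℝ} (hB : ∀ ω, |f ω| ≤ B) :
    Integrable f P :=
  Integrable.of_bound hf.aestronglyMeasurable B (Filter.Eventually.of_forall hB)

/-- One step of the exponential supermartingale. Here `H ≤ G` is the information before the round
and the information just before the arm is drawn, `y` the reward, `z` the corrupted reward, `d` a
bound on the corruption, `J` the indicator of the arm, and `p` its probability. -/
lemma integral_mul_exp_le {Ω : Type*} {H G mΩ : MeasurableSpace Ω} {P : Measure Ω}
    [IsProbabilityMeasure P] (hHG : H ≤ G) (hG : G ≤ mΩ) {W x p y z d J : Ω → ℝ} {μ B : ℝ}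
    (hμ : μ ∈ Set.Icc (0 : ℝ) 1)
    (hW : Measurable[H] W) (hx : Measurable[H] x) (hp : Measurable[H] p)
    (hy : Measurable[G] y) (hz : Measurable[G] z) (hd : Measurable[G] d) (hJ : Measurable J)
    (hW0 : ∀ ω, 0 ≤ W ω) (hWB : ∀ ω, W ω ≤ B) (hx1 : ∀ ω, |x ω| ≤ 1)
    (hpm : ∀ ω, p ω ∈ Set.Icc (0 : ℝ) 1) (hym : ∀ ω, y ω ∈ Set.Icc (0 : ℝ) 1)
    (hzm : ∀ ω, z ω ∈ Set.Icc (0 : ℝ) 1) (hdm : ∀ ω, |z ω - y ω| ≤ d ω)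
    (hJm : ∀ ω, J ω = 0 ∨ J ω = 1)
    (hJint : ∀ Y : Ω → ℝ, Measurable[G] Y → (∃ B, ∀ ω, |Y ω| ≤ B) →
      ∫ ω, Y ω * J ω ∂P = ∫ ω, Y ω * p ω ∂P)
    (hyint : ∀ V : Ω → ℝ, Measurable[H] V → (∃ B, ∀ ω, |V ω| ≤ B) →
      ∫ ω, V ω * y ω ∂P = μ * ∫ ω, V ω ∂P) :
    ∫ ω, W ω * Real.exp (x ω * (J ω * z ω) - (Real.exp (x ω) - 1) * (p ω * μ) -
      (Real.exp |x ω| - 1) * (p ω * d ω)) ∂P ≤ ∫ ω, W ω ∂P := by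
  have hHm := hHG.trans hG
  have hW' : Measurable[G] W := hW.mono hHG le_rfl
  have hx' : Measurable[G] x := hx.mono hHG le_rfl
  have hp' : Measurable[G] p := hp.mono hHG le_rfl
  have hE3 : Real.exp 1 ≤ 3 := by linarith [Real.exp_one_lt_d9]
  have hexp1 : ∀ ω, Real.exp (x ω) ≤ 3 := fun ω =>
    (Real.exp_le_exp.2 ((le_abs_self _).trans (hx1 ω))).trans hE3
  have hB : ∀ ω, 0 ≤ B := fun ω => (hW0 ω).trans (hWB ω)
  have hd0 : ∀ ω, 0 ≤ d ω := fun ω => (abs_nonneg _).trans (hdm ω)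
  have hpμ : ∀ ω, p ω * μ ∈ Set.Icc (0 : ℝ) 1 := fun ω =>
    ⟨mul_nonneg (hpm ω).1 hμ.1, mul_le_one₀ (hpm ω).2 hμ.1 hμ.2⟩
  set E2 : Ω → ℝ := fun ω => Real.exp (-((Real.exp (x ω) - 1) * (p ω * μ))) with hE2
  set E1 : Ω → ℝ := fun ω => E2 ω * Real.exp (-((Real.exp |x ω| - 1) * (p ω * d ω))) with hE1
  have hE2m : Measurable[H] E2 := by
    exact (((hx.exp.sub measurable_const).mul (hp.mul measurable_const)).neg).exp
  have hE1m : Measurable[G] E1 := by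
    have h1 : Measurable[G] fun ω => |x ω| := continuous_abs.measurable.comp hx'
    exact (hE2m.mono hHG le_rfl).mul
      ((((h1.exp.sub measurable_const).mul (hp'.mul hd)).neg).exp)
  have hE2b : ∀ ω, E2 ω ≤ 3 := fun ω => by
    refine le_trans (Real.exp_le_exp.2 ?_) hE3
    have := Real.exp_pos (x ω)
    nlinarith [(hpμ ω).1, (hpμ ω).2]
  have hE20 : ∀ ω, 0 < E2 ω := fun ω => Real.exp_pos _
  have hcorr0 : ∀ ω, 0 ≤ (Real.exp |x ω| - 1) * (p ω * d ω) := fun ω =>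
    mul_nonneg (by linarith [Real.one_le_exp (abs_nonneg (x ω))])
      (mul_nonneg (hpm ω).1 (hd0 ω))
  have hE10 : ∀ ω, 0 < E1 ω := fun ω => mul_pos (hE20 ω) (Real.exp_pos _)
  have hE1b : ∀ ω, E1 ω ≤ 3 := fun ω =>
    (mul_le_of_le_one_right (hE20 ω).le
      (Real.exp_le_one_iff.2 (neg_nonpos.2 (hcorr0 ω)))).trans (hE2b ω)
  have hexpz : ∀ ω, |Real.exp (x ω * z ω) - 1| ≤ 3 := fun ω => by
    have h1 : x ω * z ω ≤ 1 := by
      have h2 := abs_le.1 (hx1 ω)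
      have := hzm ω
      nlinarith [this.1, this.2]
    have h2 := (Real.exp_le_exp.2 h1).trans hE3
    have h3 := Real.exp_pos (x ω * z ω)
    rw [abs_le]
    constructor <;> linarith
  have hexpx : ∀ ω, |Real.exp (x ω) - 1| ≤ 3 := fun ω => by
    have h3 := Real.exp_pos (x ω)
    rw [abs_le]
    constructor <;> linarith [hexp1 ω]
  have hWE1b : ∀ ω, |W ω * E1 ω| ≤ B * 3 := fun ω => by
    rw [abs_of_nonneg (mul_nonneg (hW0 ω) (hE10 ω).le)]
    exact mul_le_mul (hWB ω) (hE1b ω) (hE10 ω).le (hB ω)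
  have hWE2b : ∀ ω, |W ω * E2 ω| ≤ B * 3 := fun ω => by
    rw [abs_of_nonneg (mul_nonneg (hW0 ω) (hE20 ω).le)]
    exact mul_le_mul (hWB ω) (hE2b ω) (hE20 ω).le (hB ω)
  set Y : Ω → ℝ := fun ω => W ω * E1 ω * (Real.exp (x ω * z ω) - 1) with hY
  set V : Ω → ℝ := fun ω => W ω * E2 ω * (p ω * (Real.exp (x ω) - 1)) with hV
  have hYm : Measurable[G] Y :=
    (hW'.mul hE1m).mul (((hx'.mul hz).exp).sub measurable_const)
  have hVm : Measurable[H] V :=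
    (hW.mul hE2m).mul (hp.mul (hx.exp.sub measurable_const))
  have hYb : ∀ ω, |Y ω| ≤ B * 3 * 3 := fun ω => by
    rw [hY, abs_mul]
    exact mul_le_mul (hWE1b ω) (hexpz ω) (abs_nonneg _) (by linarith [hB ω])
  have hVb : ∀ ω, |V ω| ≤ B * 3 * 3 := fun ω => by
    rw [hV, abs_mul]
    refine mul_le_mul (hWE2b ω) ?_ (abs_nonneg _) (by linarith [hB ω])
    rw [abs_mul, abs_of_nonneg (hpm ω).1]
    exact (mul_le_of_le_one_left (abs_nonneg _) (hpm ω).2).trans (hexpx ω)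
  have hJ1 : ∀ ω, |J ω| ≤ 1 := fun ω => by rcases hJm ω with h | h <;> simp [h]
  have hmulb : ∀ {f g : ℝ} {C : ℝ}, |f| ≤ C → |g| ≤ 1 → |f * g| ≤ C := fun {f g C} hf hg => by
    rw [abs_mul]
    exact (mul_le_of_le_one_right (abs_nonneg _) hg).trans hf
  have hp1 : ∀ ω, |p ω| ≤ 1 := fun ω => abs_le.2 ⟨by linarith [(hpm ω).1], (hpm ω).2⟩
  have hy1 : ∀ ω, |y ω| ≤ 1 := fun ω => abs_le.2 ⟨by linarith [(hym ω).1], (hym ω).2⟩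
  have hμ1 : |μ| ≤ 1 := abs_le.2 ⟨by linarith [hμ.1], hμ.2⟩
  have iWE1 : Integrable (fun ω => W ω * E1 ω) P :=
    integrable_of_abs_le ((hW'.mul hE1m).mono hG le_rfl) hWE1b
  have iWE2 : Integrable (fun ω => W ω * E2 ω) P :=
    integrable_of_abs_le ((hW.mul hE2m).mono hHm le_rfl) hWE2b
  have iYJ : Integrable (fun ω => Y ω * J ω) P :=
    integrable_of_abs_le ((hYm.mono hG le_rfl).mul hJ) fun ω => hmulb (hYb ω) (hJ1 ω)
  have iYp : Integrable (fun ω => Y ω * p ω) P :=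
    integrable_of_abs_le ((hYm.mul hp').mono hG le_rfl) fun ω => hmulb (hYb ω) (hp1 ω)
  have iVy : Integrable (fun ω => V ω * y ω) P :=
    integrable_of_abs_le (((hVm.mono hHG le_rfl).mul hy).mono hG le_rfl)
      fun ω => hmulb (hVb ω) (hy1 ω)
  have iV : Integrable V P := integrable_of_abs_le (hVm.mono hHm le_rfl) hVb
  have iW : Integrable W P := integrable_of_abs_le (hW.mono hHm le_rfl) (B := B) fun ω => by
    rw [abs_of_nonneg (hW0 ω)]; exact hWB ω
  calc ∫ ω, W ω * Real.exp (x ω * (J ω * z ω) - (Real.exp (x ω) - 1) * (p ω * μ) -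
        (Real.exp |x ω| - 1) * (p ω * d ω)) ∂P
      = ∫ ω, (W ω * E1 ω + Y ω * J ω) ∂P := by
        congr 1
        funext ω
        have h1 : Real.exp (x ω * (J ω * z ω) - (Real.exp (x ω) - 1) * (p ω * μ) -
            (Real.exp |x ω| - 1) * (p ω * d ω)) = E1 ω * Real.exp (x ω * (J ω * z ω)) := by
          rw [hE1, hE2]
          simp only
          rw [← Real.exp_add, ← Real.exp_add]
          congr 1
          ring
        rw [h1, hY]
        rcases hJm ω with h | h
        · simp [h]
        · simp only [h]
          ring_nf
    _ = ∫ ω, W ω * E1 ω ∂P + ∫ ω, Y ω * J ω ∂P := integral_add iWE1 iYJ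
    _ = ∫ ω, W ω * E1 ω ∂P + ∫ ω, Y ω * p ω ∂P := by rw [hJint Y hYm ⟨_, hYb⟩]
    _ = ∫ ω, (W ω * E1 ω + Y ω * p ω) ∂P := (integral_add iWE1 iYp).symm
    _ ≤ ∫ ω, (W ω * E2 ω + V ω * y ω) ∂P := by
        refine integral_mono (iWE1.add iYp) (iWE2.add iVy) fun ω => ?_
        have h1 := one_add_mul_exp_sub_one_le (x := x ω) (hpm ω) (hym ω) (hzm ω) (hdm ω)
        have h2 : E1 ω * (1 + p ω * (Real.exp (x ω * z ω) - 1)) ≤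
            E2 ω * (1 + p ω * y ω * (Real.exp (x ω) - 1)) := by
          calc _ ≤ E1 ω * ((1 + p ω * y ω * (Real.exp (x ω) - 1)) *
                Real.exp ((Real.exp |x ω| - 1) * (p ω * d ω))) :=
                mul_le_mul_of_nonneg_left h1 (hE10 ω).le
            _ = E2 ω * (1 + p ω * y ω * (Real.exp (x ω) - 1)) *
                (Real.exp (-((Real.exp |x ω| - 1) * (p ω * d ω))) *
                Real.exp ((Real.exp |x ω| - 1) * (p ω * d ω))) := by
                rw [hE1]; ring
            _ = _ := by rw [← Real.exp_add]; simp
        have h3 := mul_le_mul_of_nonneg_left h2 (hW0 ω)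
        simp only [hY, hV]
        linarith
    _ = ∫ ω, W ω * E2 ω ∂P + ∫ ω, V ω * y ω ∂P := integral_add iWE2 iVy
    _ = ∫ ω, W ω * E2 ω ∂P + ∫ ω, V ω * μ ∂P := by
        rw [hyint V hVm ⟨_, hVb⟩, integral_mul_const, mul_comm]
    _ = ∫ ω, (W ω * E2 ω + V ω * μ) ∂P := (integral_add iWE2 (iV.mul_const μ)).symm
    _ ≤ ∫ ω, W ω ∂P := by
        refine integral_mono (iWE2.add (iV.mul_const μ)) iW fun ω => ?_
        have h1 := Real.add_one_le_exp ((Real.exp (x ω) - 1) * (p ω * μ))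
        have h2 : E2 ω * ((Real.exp (x ω) - 1) * (p ω * μ) + 1) ≤ 1 := by
          calc _ ≤ E2 ω * Real.exp ((Real.exp (x ω) - 1) * (p ω * μ)) :=
                mul_le_mul_of_nonneg_left h1 (hE20 ω).le
            _ = 1 := by rw [hE2, ← Real.exp_add]; simp
        have h3 := mul_le_mul_of_nonneg_left h2 (hW0 ω)
        simp only [hV]
        linarith

end ExponentialMoment

/-- A run in which all rewards lie in `[0, 1]` everywhere. `H t` is the information before round
`t`, and `G t` the information just before the arm of round `t` is drawn; the laws of the rewards
and of the arms enter through their integrals against bounded test functions. -/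
structure BoundedRun {K : ℕ} [NeZero K] {Ω : Type*} [mΩ : MeasurableSpace Ω] (T L : ℕ)
    (μ : Fin K → ℝ) (P : Measure Ω) (r rt : ℕ → Ω → Fin K → ℝ) (I : ℕ → Ω → Fin K)
    (H G : ℕ → MeasurableSpace Ω) : Prop where
  mono : Monotone H
  le_G : ∀ t, H t ≤ G t
  G_le : ∀ t ∈ Finset.Icc 1 T, G t ≤ H (t + 1)
  H_le : ∀ t ≤ T + 1, H t ≤ mΩ
  measurable_reward : ∀ t ∈ Finset.Icc 1 T, ∀ k, Measurable[G t] fun ω => r t ω k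
  measurable_corrupted : ∀ t ∈ Finset.Icc 1 T, ∀ k, Measurable[G t] fun ω => rt t ω k
  measurable_arm : ∀ t ∈ Finset.Icc 1 T, Measurable[H (t + 1)] (I t)
  mean_mem : ∀ k, μ k ∈ Set.Icc (0 : ℝ) 1
  reward_mem : ∀ t ω k, r t ω k ∈ Set.Icc (0 : ℝ) 1
  corrupted_mem : ∀ t ω k, rt t ω k ∈ Set.Icc (0 : ℝ) 1
  integral_mul_reward : ∀ t ∈ Finset.Icc 1 T, ∀ k, ∀ V : Ω → ℝ, Measurable[H t] V →
    (∃ B, ∀ ω, |V ω| ≤ B) → ∫ ω, V ω * r t ω k ∂P = μ k * ∫ ω, V ω ∂P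
  integral_mul_arm : ∀ m, ∀ t ∈ Finset.Icc 1 T, epochEnd K T L m < t → t ≤ epochEnd K T L (m + 1) →
    ∀ k, ∀ Y : Ω → ℝ, Measurable[G t] Y → (∃ B, ∀ ω, |Y ω| ≤ B) →
      ∫ ω, Y ω * (if I t ω = k then 1 else 0) ∂P =
        ∫ ω, Y ω * armProb T L (fun s => I s ω) (fun s => rt s ω (I s ω)) (m + 1) k ∂P

/-- The corruption `max_k |r̃_{t,k} - r_{t,k}|` of round `t`. -/
noncomputable def roundCorruption {K : ℕ} {Ω : Type*} (r rt : ℕ → Ω → Fin K → ℝ) (t : ℕ) (ω : Ω) :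
    ℝ := ⨆ k, |rt t ω k - r t ω k|

namespace BoundedRun

variable {K T L : ℕ} [NeZero K] {Ω : Type*} [mΩ : MeasurableSpace Ω]
  {μ : Fin K → ℝ} {P : Measure Ω} {r rt : ℕ → Ω → Fin K → ℝ} {I : ℕ → Ω → Fin K}
  {H G : ℕ → MeasurableSpace Ω}

/-- The estimates after epoch `m`. -/
noncomputable abbrev est (T L : ℕ) (rt : ℕ → Ω → Fin K → ℝ) (I : ℕ → Ω → Fin K) (m : ℕ) (ω : Ω) :
    Estimates K :=
  estimates T L (fun s => I s ω) (fun s => rt s ω (I s ω)) m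

/-- The probability of arm `k` in epoch `m + 1`. -/
noncomputable abbrev prob (T L : ℕ) (rt : ℕ → Ω → Fin K → ℝ) (I : ℕ → Ω → Fin K) (m : ℕ)
    (k : Fin K) (ω : Ω) : ℝ :=
  armProb T L (fun s => I s ω) (fun s => rt s ω (I s ω)) (m + 1) k

lemma G_le_ambient (h : BoundedRun T L μ P r rt I H G) {t : ℕ} (ht : t ∈ Finset.Icc 1 T) :
    G t ≤ mΩ :=
  (h.G_le t ht).trans (h.H_le _ (Nat.succ_le_succ (Finset.mem_Icc.1 ht).2))

lemma obs_nonneg (h : BoundedRun T L μ P r rt I H G) (ω : Ω) (s : ℕ) : 0 ≤ rt s ω (I s ω) :=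
  (h.corrupted_mem s ω _).1

lemma measurable_obs (h : BoundedRun T L μ P r rt I H G) {t : ℕ} (ht : t ∈ Finset.Icc 1 T) :
    Measurable[H (t + 1)] fun ω => rt t ω (I t ω) := by
  have h1 : (fun ω => rt t ω (I t ω)) = fun ω => ∑ k, if I t ω = k then rt t ω k else 0 := by
    funext ω; simp
  rw [h1]
  exact Finset.measurable_sum _ fun k _ => Measurable.ite
    (h.measurable_arm t ht (measurableSet_singleton k))
    ((h.measurable_corrupted t ht k).mono (h.G_le t ht) le_rfl) measurable_const

lemma measurable_est (h : BoundedRun T L μ P r rt I H G) {m : ℕ} (hm : epochEnd K T L m ≤ T) :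
    (∀ k, Measurable[H (epochEnd K T L m + 1)] fun ω => (est T L rt I m ω).reward k) ∧
    ∀ k, Measurable[H (epochEnd K T L m + 1)] fun ω => (est T L rt I m ω).gap k := by
  have hmem : ∀ t ∈ Finset.Icc 1 (epochEnd K T L m), t ∈ Finset.Icc 1 T ∧
      t + 1 ≤ epochEnd K T L m + 1 := fun t ht => by
    rw [Finset.mem_Icc] at ht ⊢; omega
  exact measurable_estimates (mΩ := H (epochEnd K T L m + 1)) (arm := I)
    (obs := fun s ω => rt s ω (I s ω)) m
    (fun t ht => (h.measurable_arm t (hmem t ht).1).mono (h.mono (hmem t ht).2) le_rfl)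
    (fun t ht => (h.measurable_obs (hmem t ht).1).mono (h.mono (hmem t ht).2) le_rfl)

lemma measurable_pulls_est (h : BoundedRun T L μ P r rt I H G) {m : ℕ}
    (hm : epochEnd K T L m ≤ T) (k : Fin K) :
    Measurable[H (epochEnd K T L m + 1)] fun ω => pulls T L (m + 1) (est T L rt I m ω) k :=
  measurable_pulls (mΩ := H (epochEnd K T L m + 1)) (h.measurable_est hm).1
    (h.measurable_est hm).2 (m + 1) k

lemma prob_eq (m : ℕ) (k : Fin K) (ω : Ω) :
    prob T L rt I m k ω = pulls T L (m + 1) (est T L rt I m ω) k / epochLen K T L (m + 1) := rfl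

lemma measurable_prob (h : BoundedRun T L μ P r rt I H G) {m : ℕ}
    (hm : epochEnd K T L m ≤ T) (k : Fin K) :
    Measurable[H (epochEnd K T L m + 1)] (prob T L rt I m k) :=
  (h.measurable_pulls_est hm k).div measurable_const

lemma prob_mem (m : ℕ) (k : Fin K) (ω : Ω) : prob T L rt I m k ω ∈ Set.Icc (0 : ℝ) 1 :=
  ⟨div_nonneg (pulls_pos m k).le (epochLen_pos m).le,
    div_le_one_of_le₀ (pulls_le_epochLen m k) (epochLen_pos m).le⟩

lemma sum_prob (m : ℕ) (ω : Ω) : ∑ k, prob T L rt I m k ω = 1 := by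
  simp only [prob_eq]
  rw [← Finset.sum_div, sum_pulls, div_self (epochLen_pos m).ne']

lemma abs_sub_le_roundCorruption (t : ℕ) (ω : Ω) (k : Fin K) :
    |rt t ω k - r t ω k| ≤ roundCorruption r rt t ω :=
  le_ciSup (f := fun k => |rt t ω k - r t ω k|) (Set.finite_range _).bddAbove k

lemma roundCorruption_nonneg (t : ℕ) (ω : Ω) : 0 ≤ roundCorruption r rt t ω :=
  Real.iSup_nonneg fun _ => abs_nonneg _

lemma roundCorruption_le_one (h : BoundedRun T L μ P r rt I H G) (t : ℕ) (ω : Ω) :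
    roundCorruption r rt t ω ≤ 1 :=
  ciSup_le fun k => by
    have h1 := h.reward_mem t ω k
    have h2 := h.corrupted_mem t ω k
    rw [abs_le]
    constructor <;> linarith [h1.1, h1.2, h2.1, h2.2]

lemma measurable_roundCorruption (h : BoundedRun T L μ P r rt I H G) {t : ℕ}
    (ht : t ∈ Finset.Icc 1 T) : Measurable[G t] (roundCorruption r rt t) :=
  Measurable.iSup fun k => continuous_abs.measurable.comp
    ((h.measurable_corrupted t ht k).sub (h.measurable_reward t ht k))

/-- The exponent of the supermartingale of epoch `m + 1` after `n` rounds. -/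
noncomputable def exponent (T L : ℕ) (μ : Fin K → ℝ) (r rt : ℕ → Ω → Fin K → ℝ)
    (I : ℕ → Ω → Fin K) (m : ℕ) (k : Fin K) (x : Ω → ℝ) (n : ℕ) (ω : Ω) : ℝ :=
  ∑ t ∈ Finset.Ioc (epochEnd K T L m) (epochEnd K T L m + n),
    (x ω * ((if I t ω = k then 1 else 0) * rt t ω k) -
      (Real.exp (x ω) - 1) * (prob T L rt I m k ω * μ k) -
      (Real.exp |x ω| - 1) * (prob T L rt I m k ω * roundCorruption r rt t ω))

lemma exponent_succ (m : ℕ) (k : Fin K) (x : Ω → ℝ) (n : ℕ) (ω : Ω) :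
    exponent T L μ r rt I m k x (n + 1) ω = exponent T L μ r rt I m k x n ω +
      (x ω * ((if I (epochEnd K T L m + n + 1) ω = k then 1 else 0) *
          rt (epochEnd K T L m + n + 1) ω k) -
        (Real.exp (x ω) - 1) * (prob T L rt I m k ω * μ k) -
        (Real.exp |x ω| - 1) *
          (prob T L rt I m k ω * roundCorruption r rt (epochEnd K T L m + n + 1) ω)) := by
  unfold exponent
  rw [← add_assoc, Finset.sum_Ioc_succ_top (by omega)]

lemma exponent_le (h : BoundedRun T L μ P r rt I H G) (m : ℕ) (k : Fin K) {x : Ω → ℝ}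
    (hx1 : ∀ ω, |x ω| ≤ 1) (n : ℕ) (ω : Ω) : exponent T L μ r rt I m k x n ω ≤ 2 * n := by
  induction n with
  | zero => simp [exponent]
  | succ n ih =>
    rw [exponent_succ]
    have hp := prob_mem (T := T) (L := L) (rt := rt) (I := I) m k ω
    have hμ := h.mean_mem k
    have hz := h.corrupted_mem (epochEnd K T L m + n + 1) ω k
    have hx := abs_le.1 (hx1 ω)
    have h1 : x ω * ((if I (epochEnd K T L m + n + 1) ω = k then 1 else 0) *
        rt (epochEnd K T L m + n + 1) ω k) ≤ 1 := by
      split_ifs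
      · nlinarith [hz.1, hz.2]
      · simp
    have h2 : -1 ≤ (Real.exp (x ω) - 1) * (prob T L rt I m k ω * μ k) := by
      have h3 : prob T L rt I m k ω * μ k ≤ 1 := mul_le_one₀ hp.2 hμ.1 hμ.2
      have h4 : 0 ≤ prob T L rt I m k ω * μ k := mul_nonneg hp.1 hμ.1
      have h5 := mul_nonneg (Real.exp_pos (x ω)).le h4
      linarith [sub_mul (Real.exp (x ω)) 1 (prob T L rt I m k ω * μ k)]
    have h3 : 0 ≤ (Real.exp |x ω| - 1) *
        (prob T L rt I m k ω * roundCorruption r rt (epochEnd K T L m + n + 1) ω) :=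
      mul_nonneg (by linarith [Real.one_le_exp (abs_nonneg (x ω))])
        (mul_nonneg hp.1 (roundCorruption_nonneg _ ω))
    push_cast
    linarith

lemma measurable_exponent (h : BoundedRun T L μ P r rt I H G) {m : ℕ} (k : Fin K) {x : Ω → ℝ}
    (hx : Measurable[H (epochEnd K T L m + 1)] x) (n : ℕ) (hn : epochEnd K T L m + n ≤ T) :
    Measurable[H (epochEnd K T L m + n + 1)] (exponent T L μ r rt I m k x n) := by
  have hm : epochEnd K T L m ≤ T := by omega
  have hle : H (epochEnd K T L m + 1) ≤ H (epochEnd K T L m + n + 1) := h.mono (by omega)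
  have hx' := hx.mono hle le_rfl
  have hp' := (h.measurable_prob hm k).mono hle le_rfl
  refine Finset.measurable_sum _ fun t ht => ?_
  rw [Finset.mem_Ioc] at ht
  have ht' : t ∈ Finset.Icc 1 T := Finset.mem_Icc.2 (by omega)
  have hle2 : H (t + 1) ≤ H (epochEnd K T L m + n + 1) := h.mono (by omega)
  have hG2 : G t ≤ H (epochEnd K T L m + n + 1) := (h.G_le t ht').trans hle2
  have hJ : Measurable[H (epochEnd K T L m + n + 1)] fun ω => if I t ω = k then (1 : ℝ) else 0 :=
    Measurable.ite (((h.measurable_arm t ht').mono hle2 le_rfl) (measurableSet_singleton k))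
      measurable_const measurable_const
  have habs : Measurable[H (epochEnd K T L m + n + 1)] fun ω => |x ω| :=
    continuous_abs.measurable.comp hx'
  exact ((hx'.mul (hJ.mul ((h.measurable_corrupted t ht' k).mono hG2 le_rfl))).sub
    ((hx'.exp.sub measurable_const).mul (hp'.mul measurable_const))).sub
    ((habs.exp.sub measurable_const).mul
      (hp'.mul ((h.measurable_roundCorruption ht').mono hG2 le_rfl)))

lemma integral_exp_exponent_le_one [IsProbabilityMeasure P] (h : BoundedRun T L μ P r rt I H G)
    {m : ℕ} (k : Fin K) {x : Ω → ℝ} (hx : Measurable[H (epochEnd K T L m + 1)] x)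
    (hx1 : ∀ ω, |x ω| ≤ 1) (n : ℕ) (hnT : epochEnd K T L m + n ≤ T)
    (hn : n ≤ epochLen K T L (m + 1)) :
    ∫ ω, Real.exp (exponent T L μ r rt I m k x n ω) ∂P ≤ 1 := by
  induction n with
  | zero => simp [exponent]
  | succ n ih =>
    refine le_trans ?_ (ih (by omega) (by omega))
    have ht : epochEnd K T L m + n + 1 ∈ Finset.Icc 1 T := Finset.mem_Icc.2 (by omega)
    have hle : H (epochEnd K T L m + 1) ≤ H (epochEnd K T L m + n + 1) := h.mono (by omega)
    simp only [exponent_succ, Real.exp_add]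
    refine integral_mul_exp_le (P := P) (h.le_G (epochEnd K T L m + n + 1)) (h.G_le_ambient ht)
      (y := fun ω => r (epochEnd K T L m + n + 1) ω k) (B := Real.exp (2 * n))
      (J := fun ω => if I (epochEnd K T L m + n + 1) ω = k then 1 else 0)
      (z := fun ω => rt (epochEnd K T L m + n + 1) ω k) (p := prob T L rt I m k)
      (d := roundCorruption r rt (epochEnd K T L m + n + 1)) (h.mean_mem k)
      (h.measurable_exponent k hx n (by omega)).exp
      (hx.mono hle le_rfl) ((h.measurable_prob (by omega) k).mono hle le_rfl)
      (h.measurable_reward _ ht k) (h.measurable_corrupted _ ht k)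
      (h.measurable_roundCorruption ht) ?_ (fun ω => (Real.exp_pos _).le)
      (fun ω => Real.exp_le_exp.2 (h.exponent_le m k hx1 n ω)) hx1 (prob_mem m k)
      (fun ω => h.reward_mem _ ω k) (fun ω => h.corrupted_mem _ ω k)
      (fun ω => abs_sub_le_roundCorruption _ ω k) (fun ω => ?_) ?_
      (h.integral_mul_reward _ ht k)
    · exact Measurable.ite (((h.measurable_arm _ ht).mono
        (h.H_le _ (by rw [Finset.mem_Icc] at ht; omega)) le_rfl) (measurableSet_singleton k))
        measurable_const measurable_const
    · split_ifs <;> simp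
    · exact h.integral_mul_arm m _ ht (by omega) (by rw [epochEnd]; omega) k

/-- Where the exponentials stay below `e ^ ℓ`, the estimate is accurate. -/
lemma abs_div_sub_le {S n N μ D l s p : ℝ} (hl : 0 < l) (hn : l ≤ n) (hN : 0 < N) (hμ : μ ≤ 1)
    (hμ0 : 0 ≤ μ) (hD : 0 ≤ D) (hp : p = n / N) (hs : s = √(l / n))
    (h1 : s * S - (Real.exp s - 1) * (n * μ) - (Real.exp |s| - 1) * (p * D) < l)
    (h2 : -s * S - (Real.exp (-s) - 1) * (n * μ) - (Real.exp |-s| - 1) * (p * D) < l) :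
    |S / n - μ| ≤ 2 * s + 2 * D / N := by
  have hn0 : 0 < n := hl.trans_le hn
  have hs0 : 0 < s := by rw [hs]; positivity
  have hsq : s ^ 2 * n = l := by
    rw [hs, Real.sq_sqrt (by positivity)]; field_simp
  have hs1 : s ≤ 1 := by
    rw [hs]; exact Real.sqrt_le_one.2 (div_le_one_of_le₀ hn hn0.le)
  have hp0 : 0 ≤ p := by rw [hp]; positivity
  rw [abs_neg, abs_of_pos hs0] at h2
  rw [abs_of_pos hs0] at h1
  have e1 := (abs_le.1 (Real.abs_exp_sub_one_sub_id_le (x := s) (abs_le.2 ⟨by linarith, hs1⟩))).2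
  have e2 := (abs_le.1 (Real.abs_exp_sub_one_sub_id_le (x := -s)
    (abs_le.2 ⟨by linarith, by linarith⟩))).2
  have hnμ : 0 ≤ n * μ := by positivity
  have hnμ1 : s ^ 2 * (n * μ) ≤ l := by
    rw [← mul_assoc, hsq]; exact mul_le_of_le_one_right hl.le hμ
  have hpD : 0 ≤ p * D := by positivity
  have e3 : (Real.exp s - 1) * (p * D) ≤ 2 * s * (p * D) := by
    gcongr
    nlinarith
  have e4 : (Real.exp s - 1) * (n * μ) ≤ (s + s ^ 2) * (n * μ) := by
    gcongr; linarith
  have e5 : (Real.exp (-s) - 1) * (n * μ) ≤ (-s + s ^ 2) * (n * μ) := by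
    gcongr; linarith [neg_sq s]
  have f1 : s * (S - n * μ) ≤ s * (2 * s * n + 2 * (p * D)) := by nlinarith
  have f2 : s * (-(S - n * μ)) ≤ s * (2 * s * n + 2 * (p * D)) := by nlinarith
  have g1 := le_of_mul_le_mul_left f1 hs0
  have g2 := le_of_mul_le_mul_left f2 hs0
  have hfin : S / n - μ = (S - n * μ) / n := by field_simp
  have hrhs : 2 * s + 2 * D / N = (2 * s * n + 2 * (p * D)) / n := by
    rw [hp]; field_simp
  rw [hfin, hrhs, abs_div, abs_of_pos hn0]
  gcongr
  exact abs_le.2 ⟨by linarith, g1⟩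

/-- The two tilting parameters `± √(ln (4 / β_m) / ñ_k^m)`. -/
noncomputable def tilt (T L : ℕ) (rt : ℕ → Ω → Fin K → ℝ) (I : ℕ → Ω → Fin K) (m : ℕ)
    (k : Fin K) (σ : ℝ) (ω : Ω) : ℝ :=
  σ * √(logTerm K T L (m + 1) / pulls T L (m + 1) (est T L rt I m ω) k)

lemma logTerm_le_lam (m : ℕ) : logTerm K T L m ≤ lam K T L m := by
  rw [lam_eq]
  exact le_mul_of_one_le_left (logTerm_pos m).le (one_le_pow₀ one_le_base)

lemma abs_tilt_le_one (h : BoundedRun T L μ P r rt I H G) (m : ℕ) (k : Fin K) {σ : ℝ}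
    (hσ : |σ| = 1) (ω : Ω) : |tilt T L rt I m k σ ω| ≤ 1 := by
  unfold tilt
  rw [abs_mul, hσ, one_mul, abs_of_nonneg (Real.sqrt_nonneg _)]
  exact Real.sqrt_le_one.2 (div_le_one_of_le₀
    ((logTerm_le_lam _).trans (lam_le_pulls (h.obs_nonneg ω) m k)) (pulls_pos m k).le)

lemma measurable_tilt (h : BoundedRun T L μ P r rt I H G) {m : ℕ} (hm : epochEnd K T L m ≤ T)
    (k : Fin K) (σ : ℝ) : Measurable[H (epochEnd K T L m + 1)] (tilt T L rt I m k σ) :=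
  measurable_const.mul (measurable_const.div (h.measurable_pulls_est hm k)).sqrt

/-- The event that the supermartingale of arm `k` in epoch `m + 1` is large. -/
def badEvent (T L : ℕ) (μ : Fin K → ℝ) (r rt : ℕ → Ω → Fin K → ℝ) (I : ℕ → Ω → Fin K)
    (m : ℕ) (k : Fin K) (σ : ℝ) : Set Ω :=
  {ω | Real.exp (logTerm K T L (m + 1)) ≤ Real.exp (exponent T L μ r rt I m k
    (tilt T L rt I m k σ) (epochLen K T L (m + 1)) ω)}

lemma measurable_exp_exponent_tilt (h : BoundedRun T L μ P r rt I H G) {m : ℕ}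
    (hm : epochEnd K T L (m + 1) ≤ T) (k : Fin K) (σ : ℝ) :
    Measurable fun ω => Real.exp (exponent T L μ r rt I m k
      (tilt T L rt I m k σ) (epochLen K T L (m + 1)) ω) := by
  rw [epochEnd] at hm
  exact ((h.measurable_exponent k (h.measurable_tilt (by omega) k σ) _ hm).mono
    (h.H_le _ (by omega)) le_rfl).exp

lemma measurableSet_badEvent (h : BoundedRun T L μ P r rt I H G) {m : ℕ}
    (hm : epochEnd K T L (m + 1) ≤ T) (k : Fin K) (σ : ℝ) :
    MeasurableSet (badEvent T L μ r rt I m k σ) :=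
  measurableSet_le measurable_const (h.measurable_exp_exponent_tilt hm k σ)

lemma measureReal_badEvent_le [IsProbabilityMeasure P] (h : BoundedRun T L μ P r rt I H G) {m : ℕ}
    (hm : epochEnd K T L (m + 1) ≤ T) (k : Fin K) {σ : ℝ} (hσ : |σ| = 1) :
    P.real (badEvent T L μ r rt I m k σ) ≤ delta K T L (m + 1) / (4 * K) := by
  have hm' := hm
  rw [epochEnd] at hm'
  have hint : Integrable (fun ω => Real.exp (exponent T L μ r rt I m k
      (tilt T L rt I m k σ) (epochLen K T L (m + 1)) ω)) P :=
    integrable_of_abs_le (h.measurable_exp_exponent_tilt hm k σ)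
      (B := Real.exp (2 * (epochLen K T L (m + 1) : ℕ))) fun ω => by
        rw [abs_of_pos (Real.exp_pos _)]
        exact Real.exp_le_exp.2 (h.exponent_le m k (h.abs_tilt_le_one m k hσ) _ ω)
  have h1 := mul_meas_ge_le_integral_of_nonneg
    (Filter.Eventually.of_forall fun ω => (Real.exp_pos _).le) hint
    (Real.exp (logTerm K T L (m + 1)))
  have h2 := h.integral_exp_exponent_le_one k (h.measurable_tilt (by omega) k σ)
    (h.abs_tilt_le_one m k hσ) _ hm' le_rfl
  have hd := delta_pos (K := K) (T := T) (L := L) (m + 1)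
  have hK := one_le_cast_arms K
  have h3 : Real.exp (logTerm K T L (m + 1)) = 4 * K / delta K T L (m + 1) := by
    rw [logTerm, Real.exp_log (by positivity)]
  have h4 : 4 * K / delta K T L (m + 1) * P.real (badEvent T L μ r rt I m k σ) ≤ 1 := by
    rw [← h3]
    exact h1.trans h2
  rw [div_mul_eq_mul_div, div_le_one hd] at h4
  rw [le_div_iff₀ (by positivity)]
  linarith

/-- The total corruption of the rounds of epoch `m + 1`. -/
noncomputable def epochCorruption (T L : ℕ) (r rt : ℕ → Ω → Fin K → ℝ) (m : ℕ) (ω : Ω) : ℝ :=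
  ∑ t ∈ Finset.Ioc (epochEnd K T L m) (epochEnd K T L (m + 1)), roundCorruption r rt t ω

lemma integrable_roundCorruption [IsProbabilityMeasure P] (h : BoundedRun T L μ P r rt I H G)
    {t : ℕ} (ht : t ∈ Finset.Icc 1 T) : Integrable (roundCorruption r rt t) P :=
  integrable_of_abs_le ((h.measurable_roundCorruption ht).mono (h.G_le_ambient ht) le_rfl) (B := 1)
    fun ω => by
      rw [abs_of_nonneg (roundCorruption_nonneg t ω)]
      exact h.roundCorruption_le_one t ω

lemma integrable_epochCorruption [IsProbabilityMeasure P] (h : BoundedRun T L μ P r rt I H G)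
    {m : ℕ} (hm : epochEnd K T L (m + 1) ≤ T) : Integrable (epochCorruption T L r rt m) P :=
  integrable_finsetSum _ fun t ht => h.integrable_roundCorruption <| by
    rw [Finset.mem_Ioc] at ht
    exact Finset.mem_Icc.2 (by omega)

lemma exponent_epochLen (m : ℕ) (k : Fin K) (x : Ω → ℝ) (ω : Ω) :
    exponent T L μ r rt I m k x (epochLen K T L (m + 1)) ω =
      x ω * epochSum T L (fun s => I s ω) (fun s => rt s ω (I s ω)) m k -
      (Real.exp (x ω) - 1) * (pulls T L (m + 1) (est T L rt I m ω) k * μ k) -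
      (Real.exp |x ω| - 1) * (prob T L rt I m k ω * epochCorruption T L r rt m ω) := by
  have h1 : ∀ t, (if I t ω = k then rt t ω (I t ω) else 0) =
      (if I t ω = k then 1 else 0) * rt t ω k := fun t => by
    split_ifs with h <;> simp [h]
  have hcard : (epochLen K T L (m + 1) : ℝ) * prob T L rt I m k ω =
      pulls T L (m + 1) (est T L rt I m ω) k := by
    rw [prob_eq]
    have := epochLen_pos (K := K) (T := T) (L := L) m
    field_simp
  unfold exponent epochSum epochCorruption
  rw [epochEnd, Finset.sum_sub_distrib, Finset.sum_sub_distrib, ← Finset.mul_sum, ← Finset.mul_sum,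
    ← Finset.mul_sum, Finset.sum_const, Nat.card_Ioc, Nat.add_sub_cancel_left, nsmul_eq_mul,
    ← hcard]
  simp only [h1, mul_assoc, ← Finset.mul_sum]
  ring

/-- The estimation error of epoch `m + 1` beyond the confidence radius is at most this quantity. -/
noncomputable def epochError (T L : ℕ) (μ : Fin K → ℝ) (r rt : ℕ → Ω → Fin K → ℝ)
    (I : ℕ → Ω → Fin K) (m : ℕ) (ω : Ω) : ℝ :=
  2 * epochCorruption T L r rt m ω / epochLen K T L (m + 1) +
    ∑ k, ((badEvent T L μ r rt I m k 1).indicator 1 ω +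
      (badEvent T L μ r rt I m k (-1)).indicator 1 ω)

lemma epochCorruption_nonneg (m : ℕ) (ω : Ω) : 0 ≤ epochCorruption T L r rt m ω :=
  Finset.sum_nonneg fun t _ => roundCorruption_nonneg t ω

lemma indicator_one_nonneg (A : Set Ω) (ω : Ω) : (0 : ℝ) ≤ A.indicator 1 ω :=
  Set.indicator_nonneg (fun _ _ => zero_le_one) ω

lemma epochError_nonneg (m : ℕ) (ω : Ω) : 0 ≤ epochError T L μ r rt I m ω :=
  add_nonneg (div_nonneg (mul_nonneg zero_le_two (epochCorruption_nonneg m ω))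
    (Nat.cast_nonneg _)) (Finset.sum_nonneg fun _ _ =>
      add_nonneg (indicator_one_nonneg _ ω) (indicator_one_nonneg _ ω))

lemma abs_reward_sub_le (h : BoundedRun T L μ P r rt I H G) (m : ℕ) (k : Fin K) (ω : Ω) :
    |(est T L rt I (m + 1) ω).reward k - μ k| ≤
      radius T L (m + 1) (est T L rt I m ω) k + epochError T L μ r rt I m ω := by
  have hμ := h.mean_mem k
  have hrad := radius_nonneg (T := T) (L := L) (m + 1) (est T L rt I m ω) k
  have hc := div_nonneg (mul_nonneg zero_le_two (epochCorruption_nonneg (T := T) (L := L)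
    (r := r) (rt := rt) m ω)) (epochLen_pos (K := K) (T := T) (L := L) m).le
  have hN := epochLen_pos (K := K) (T := T) (L := L) m
  by_cases hbad : ω ∈ badEvent T L μ r rt I m k 1 ∨ ω ∈ badEvent T L μ r rt I m k (-1)
  · have h1 : (1 : ℝ) ≤ ∑ k, ((badEvent T L μ r rt I m k 1).indicator 1 ω +
        (badEvent T L μ r rt I m k (-1)).indicator 1 ω) := by
      refine le_trans ?_ (Finset.single_le_sum (fun j _ => add_nonneg
        (indicator_one_nonneg (badEvent T L μ r rt I m j 1) ω)
        (indicator_one_nonneg (badEvent T L μ r rt I m j (-1)) ω)) (Finset.mem_univ k))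
      have e1 := indicator_one_nonneg (badEvent T L μ r rt I m k 1) ω
      have e2 := indicator_one_nonneg (badEvent T L μ r rt I m k (-1)) ω
      rcases hbad with hb | hb
      · rw [Set.indicator_of_mem hb]; simpa using e2
      · rw [Set.indicator_of_mem hb (1 : Ω → ℝ)]; simpa using e1
    have h2 := estimates_reward_mem (T := T) (L := L) (arm := fun s => I s ω)
      (h.obs_nonneg ω) (m + 1) k
    have h3 : |(est T L rt I (m + 1) ω).reward k - μ k| ≤ 1 :=
      abs_le.2 ⟨by linarith [h2.1, hμ.2], by linarith [h2.2, hμ.1]⟩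
    unfold epochError
    linarith
  · rw [not_or] at hbad
    have hn := lam_le_pulls (T := T) (L := L) (arm := fun s => I s ω) (h.obs_nonneg ω) m k
    have hb1 := hbad.1
    have hb2 := hbad.2
    rw [badEvent, Set.mem_ofPred_eq, not_le, Real.exp_lt_exp, exponent_epochLen] at hb1 hb2
    simp only [tilt, one_mul, neg_mul] at hb1 hb2
    have key := abs_div_sub_le (logTerm_pos (m + 1))
      ((logTerm_le_lam (m + 1)).trans hn) hN hμ.2 hμ.1
      (epochCorruption_nonneg (T := T) (L := L) (r := r) (rt := rt) m ω)
      (prob_eq (rt := rt) (I := I) m k ω) rfl hb1 (by rw [neg_mul]; exact hb2)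
    have h4 : radius T L (m + 1) (est T L rt I m ω) k =
        2 * √(logTerm K T L (m + 1) / pulls T L (m + 1) (est T L rt I m ω) k) := by
      unfold radius
      rw [mul_div_assoc, Real.sqrt_mul (by norm_num), show (4 : ℝ) = 2 ^ 2 by norm_num,
        Real.sqrt_sq zero_le_two]
    have h5 : 2 * epochCorruption T L r rt m ω / epochLen K T L (m + 1) ≤
        epochError T L μ r rt I m ω :=
      le_add_of_nonneg_right (Finset.sum_nonneg fun _ _ =>
        add_nonneg (indicator_one_nonneg _ ω) (indicator_one_nonneg _ ω))
    rw [estimates_succ_reward, h4]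
    refine le_trans ?_ (key.trans (by linarith))
    rcases le_total (epochSum T L (fun s => I s ω) (fun s => rt s ω (I s ω)) m k /
      pulls T L (m + 1) (est T L rt I m ω) k) 1 with h6 | h6
    · rw [min_eq_left h6]
    · rw [min_eq_right h6, abs_of_nonneg (by linarith [hμ.2])]
      exact le_trans (by linarith) (le_abs_self _)

lemma integrable_indicator_badEvent [IsProbabilityMeasure P] (h : BoundedRun T L μ P r rt I H G)
    {m : ℕ} (hm : epochEnd K T L (m + 1) ≤ T) (k : Fin K) (σ : ℝ) :
    Integrable (fun ω => (badEvent T L μ r rt I m k σ).indicator (1 : Ω → ℝ) ω) P :=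
  (integrable_const (1 : ℝ)).indicator (h.measurableSet_badEvent hm k σ)

lemma integrable_epochError [IsProbabilityMeasure P] (h : BoundedRun T L μ P r rt I H G)
    {m : ℕ} (hm : epochEnd K T L (m + 1) ≤ T) : Integrable (epochError T L μ r rt I m) P :=
  (((h.integrable_epochCorruption hm).const_mul 2).div_const _).add
    (integrable_finsetSum _ fun k _ => (h.integrable_indicator_badEvent hm k 1).add
      (h.integrable_indicator_badEvent hm k (-1)))

lemma epochLen_mul_integral_epochError_le [IsProbabilityMeasure P]
    (h : BoundedRun T L μ P r rt I H G) {m : ℕ} (hm : epochEnd K T L (m + 1) ≤ T) :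
    epochLen K T L (m + 1) * ∫ ω, epochError T L μ r rt I m ω ∂P ≤
      2 * ∫ ω, epochCorruption T L r rt m ω ∂P +
        epochLen K T L (m + 1) * delta K T L (m + 1) := by
  have hN := epochLen_pos (K := K) (T := T) (L := L) m
  have hd := delta_pos (K := K) (T := T) (L := L) (m + 1)
  have hK := one_le_cast_arms K
  have h1 : ∫ ω, epochError T L μ r rt I m ω ∂P =
      2 * (∫ ω, epochCorruption T L r rt m ω ∂P) / epochLen K T L (m + 1) +
      ∑ k, (P.real (badEvent T L μ r rt I m k 1) + P.real (badEvent T L μ r rt I m k (-1))) := by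
    have hi : ∀ k ∈ Finset.univ, Integrable (fun ω =>
        (badEvent T L μ r rt I m k 1).indicator (1 : Ω → ℝ) ω +
          (badEvent T L μ r rt I m k (-1)).indicator (1 : Ω → ℝ) ω) P := fun k _ =>
      (h.integrable_indicator_badEvent hm k 1).add (h.integrable_indicator_badEvent hm k (-1))
    unfold epochError
    rw [integral_add (((h.integrable_epochCorruption hm).const_mul 2).div_const _)
      (integrable_finsetSum _ hi), integral_div, integral_const_mul, integral_finsetSum _ hi]
    congr 1
    refine Finset.sum_congr rfl fun k _ => ?_
    rw [integral_add (h.integrable_indicator_badEvent hm k 1)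
      (h.integrable_indicator_badEvent hm k (-1)),
      integral_indicator_one (h.measurableSet_badEvent hm k 1),
      integral_indicator_one (h.measurableSet_badEvent hm k (-1))]
  have h2 : ∑ k, (P.real (badEvent T L μ r rt I m k 1) +
      P.real (badEvent T L μ r rt I m k (-1))) ≤ delta K T L (m + 1) := by
    calc _ ≤ ∑ _k : Fin K, (delta K T L (m + 1) / (4 * K) + delta K T L (m + 1) / (4 * K)) :=
          Finset.sum_le_sum fun k _ => add_le_add
            (h.measureReal_badEvent_le hm k (by simp)) (h.measureReal_badEvent_le hm k (by simp))
      _ = delta K T L (m + 1) / 2 := by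
          rw [Finset.sum_const, Finset.card_univ, Fintype.card_fin, nsmul_eq_mul]
          field_simp
          ring
      _ ≤ _ := by linarith
  rw [h1, mul_add]
  have h3 : (epochLen K T L (m + 1) : ℝ) *
      (2 * (∫ ω, epochCorruption T L r rt m ω ∂P) / epochLen K T L (m + 1)) =
      2 * ∫ ω, epochCorruption T L r rt m ω ∂P := by field_simp
  rw [h3]
  gcongr

end BoundedRun

namespace BoundedRun

variable {K T L : ℕ} [NeZero K] {Ω : Type*} [mΩ : MeasurableSpace Ω]
  {μ : Fin K → ℝ} {P : Measure Ω} {r rt : ℕ → Ω → Fin K → ℝ} {I : ℕ → Ω → Fin K}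
  {H G : ℕ → MeasurableSpace Ω} [IsProbabilityMeasure P]

lemma abs_reward_le (h : BoundedRun T L μ P r rt I H G) (t : ℕ) (ω : Ω) (k : Fin K) :
    |r t ω k| ≤ 1 :=
  abs_le.2 ⟨by linarith [(h.reward_mem t ω k).1], (h.reward_mem t ω k).2⟩

lemma measurable_ite_arm (h : BoundedRun T L μ P r rt I H G) {t : ℕ} (ht : t ∈ Finset.Icc 1 T)
    (k : Fin K) : Measurable fun ω => if I t ω = k then (1 : ℝ) else 0 :=
  Measurable.ite (((h.measurable_arm t ht).mono
    (h.H_le _ (by rw [Finset.mem_Icc] at ht; omega)) le_rfl) (measurableSet_singleton k))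
    measurable_const measurable_const

lemma integrable_reward (h : BoundedRun T L μ P r rt I H G) {t : ℕ} (ht : t ∈ Finset.Icc 1 T)
    (k : Fin K) : Integrable (fun ω => r t ω k) P :=
  integrable_of_abs_le ((h.measurable_reward t ht k).mono (h.G_le_ambient ht) le_rfl)
    fun ω => h.abs_reward_le t ω k

lemma integrable_reward_ite (h : BoundedRun T L μ P r rt I H G) {t : ℕ}
    (ht : t ∈ Finset.Icc 1 T) (k : Fin K) :
    Integrable (fun ω => r t ω k * if I t ω = k then 1 else 0) P :=
  integrable_of_abs_le (((h.measurable_reward t ht k).mono (h.G_le_ambient ht) le_rfl).mul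
    (h.measurable_ite_arm ht k)) (B := 1) fun ω => by
      have := h.abs_reward_le t ω k
      split_ifs <;> simp [this]

lemma reward_arm_eq (t : ℕ) (ω : Ω) :
    r t ω (I t ω) = ∑ k, r t ω k * if I t ω = k then 1 else 0 := by
  simp

lemma integrable_reward_arm (h : BoundedRun T L μ P r rt I H G) {t : ℕ}
    (ht : t ∈ Finset.Icc 1 T) : Integrable (fun ω => r t ω (I t ω)) P := by
  simp only [reward_arm_eq]
  exact integrable_finsetSum _ fun k _ => h.integrable_reward_ite ht k

lemma integral_reward (h : BoundedRun T L μ P r rt I H G) {t : ℕ} (ht : t ∈ Finset.Icc 1 T)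
    (k : Fin K) : ∫ ω, r t ω k ∂P = μ k := by
  have := h.integral_mul_reward t ht k (fun _ => 1) measurable_const ⟨1, fun _ => by simp⟩
  simpa using this

lemma abs_prob_le (m : ℕ) (k : Fin K) (ω : Ω) : |prob T L rt I m k ω| ≤ 1 :=
  abs_le.2 ⟨by linarith [(prob_mem (T := T) (L := L) (rt := rt) (I := I) m k ω).1],
    (prob_mem m k ω).2⟩

lemma integrable_prob (h : BoundedRun T L μ P r rt I H G) {m : ℕ} (hm : epochEnd K T L m ≤ T)
    (k : Fin K) : Integrable (prob T L rt I m k) P :=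
  integrable_of_abs_le ((h.measurable_prob hm k).mono (h.H_le _ (by omega)) le_rfl)
    fun ω => abs_prob_le m k ω

lemma integral_reward_arm (h : BoundedRun T L μ P r rt I H G) {m t : ℕ}
    (ht : t ∈ Finset.Icc 1 T) (h1 : epochEnd K T L m < t) (h2 : t ≤ epochEnd K T L (m + 1)) :
    ∫ ω, r t ω (I t ω) ∂P = ∑ k, μ k * ∫ ω, prob T L rt I m k ω ∂P := by
  have hm : epochEnd K T L m ≤ T := by rw [Finset.mem_Icc] at ht; omega
  simp only [reward_arm_eq]
  rw [integral_finsetSum _ fun k _ => h.integrable_reward_ite ht k]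
  refine Finset.sum_congr rfl fun k _ => ?_
  rw [h.integral_mul_arm m t ht h1 h2 k (fun ω => r t ω k) (h.measurable_reward t ht k)
    ⟨1, fun ω => h.abs_reward_le t ω k⟩, ← h.integral_mul_reward t ht k (prob T L rt I m k)
    ((h.measurable_prob hm k).mono (h.mono (by omega)) le_rfl) ⟨1, abs_prob_le m k⟩]
  simp only [mul_comm]

/-- The pseudo-regret of epoch `m + 1`, if it is not cut off. -/
noncomputable def epochRegret (T L : ℕ) (μ : Fin K → ℝ) (rt : ℕ → Ω → Fin K → ℝ)
    (I : ℕ → Ω → Fin K) (m : ℕ) (ω : Ω) : ℝ :=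
  ∑ k, ((⨆ j, μ j) - μ k) * pulls T L (m + 1) (est T L rt I m ω) k

lemma le_iSup_mean (k : Fin K) : μ k ≤ ⨆ j, μ j :=
  le_ciSup (Set.finite_range μ).bddAbove k

lemma epochRegret_nonneg (m : ℕ) (ω : Ω) : 0 ≤ epochRegret T L μ rt I m ω :=
  Finset.sum_nonneg fun k _ => mul_nonneg (sub_nonneg.2 (le_iSup_mean k)) (pulls_pos m k).le

lemma pulls_eq_mul_prob (m : ℕ) (k : Fin K) (ω : Ω) :
    pulls T L (m + 1) (est T L rt I m ω) k = epochLen K T L (m + 1) * prob T L rt I m k ω := by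
  rw [prob_eq]
  have := epochLen_pos (K := K) (T := T) (L := L) m
  field_simp

lemma integrable_epochRegret (h : BoundedRun T L μ P r rt I H G) {m : ℕ}
    (hm : epochEnd K T L m ≤ T) : Integrable (epochRegret T L μ rt I m) P := by
  unfold epochRegret
  simp only [pulls_eq_mul_prob]
  exact integrable_finsetSum _ fun k _ => ((h.integrable_prob hm k).const_mul _).const_mul _

lemma round_regret (h : BoundedRun T L μ P r rt I H G) {m t : ℕ}
    (ht : t ∈ Finset.Icc 1 T) (h1 : epochEnd K T L m < t) (h2 : t ≤ epochEnd K T L (m + 1)) :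
    (⨆ j, μ j) - ∫ ω, r t ω (I t ω) ∂P =
      (∫ ω, epochRegret T L μ rt I m ω ∂P) / epochLen K T L (m + 1) := by
  have hm : epochEnd K T L m ≤ T := by rw [Finset.mem_Icc] at ht; omega
  have hN := epochLen_pos (K := K) (T := T) (L := L) m
  have hsum : ∑ k, ∫ ω, prob T L rt I m k ω ∂P = 1 := by
    rw [← integral_finsetSum _ fun k _ => h.integrable_prob hm k]
    simp [sum_prob]
  rw [h.integral_reward_arm ht h1 h2]
  unfold epochRegret
  simp only [pulls_eq_mul_prob]
  rw [integral_finsetSum _ fun k _ => ((h.integrable_prob hm k).const_mul _).const_mul _]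
  simp only [integral_const_mul]
  rw [Finset.sum_div, eq_comm]
  calc _ = ∑ k, ((⨆ j, μ j) * ∫ ω, prob T L rt I m k ω ∂P -
        μ k * ∫ ω, prob T L rt I m k ω ∂P) := Finset.sum_congr rfl fun k _ => by
        field_simp
    _ = _ := by rw [Finset.sum_sub_distrib, ← Finset.mul_sum, hsum, mul_one]

lemma regret_eq (h : BoundedRun T L μ P r rt I H G) :
    regret T P r I = ∑ t ∈ Finset.Ioc 0 T, ((⨆ j, μ j) - ∫ ω, r t ω (I t ω) ∂P) := by
  have hIoc : Finset.Icc 1 T = Finset.Ioc 0 T := by ext; simp; omega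
  unfold regret
  rw [integral_finsetSum _ fun t ht => h.integrable_reward_arm ht]
  have h1 : ∀ k, ∫ ω, ∑ t ∈ Finset.Icc 1 T, r t ω k ∂P = T * μ k := fun k => by
    rw [integral_finsetSum _ fun t ht => h.integrable_reward ht k,
      Finset.sum_congr rfl fun t ht => h.integral_reward ht k]
    simp
  simp only [h1]
  rw [← Real.mul_iSup_of_nonneg (Nat.cast_nonneg T), Finset.sum_sub_distrib, hIoc]
  simp

lemma regret_le_sum (h : BoundedRun T L μ P r rt I H G) {M : ℕ}
    (hM : ∀ m < M, epochEnd K T L m < T) (hT : T ≤ epochEnd K T L M) :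
    regret T P r I ≤ ∑ m ∈ Finset.range M, ∫ ω, epochRegret T L μ rt I m ω ∂P := by
  suffices hs : ∀ n ≤ M, ∑ t ∈ Finset.Ioc 0 (min T (epochEnd K T L n)),
      ((⨆ j, μ j) - ∫ ω, r t ω (I t ω) ∂P) ≤
        ∑ m ∈ Finset.range n, ∫ ω, epochRegret T L μ rt I m ω ∂P by
    have := hs M le_rfl
    rwa [min_eq_left hT, ← h.regret_eq] at this
  intro n hn
  induction n with
  | zero => simp [epochEnd]
  | succ n ih =>
    have ih := ih (by omega)
    have hlt := hM n (by omega)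
    rw [min_eq_right hlt.le] at ih
    have hmono : epochEnd K T L n ≤ epochEnd K T L (n + 1) := epochEnd_mono (Nat.le_succ n)
    have hle : epochEnd K T L n ≤ min T (epochEnd K T L (n + 1)) := le_min hlt.le hmono
    have hN := epochLen_pos (K := K) (T := T) (L := L) n
    rw [← Finset.sum_Ioc_consecutive _ (Nat.zero_le _) hle, Finset.sum_range_succ]
    refine add_le_add ih ?_
    have hQ : 0 ≤ ∫ ω, epochRegret T L μ rt I n ω ∂P :=
      integral_nonneg fun ω => epochRegret_nonneg n ω
    have hcard : ((min T (epochEnd K T L (n + 1)) - epochEnd K T L n : ℕ) : ℝ) ≤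
        epochLen K T L (n + 1) := by
      have : min T (epochEnd K T L (n + 1)) - epochEnd K T L n ≤ epochLen K T L (n + 1) := by
        have := min_le_right T (epochEnd K T L (n + 1))
        have h2 : epochEnd K T L (n + 1) = epochEnd K T L n + epochLen K T L (n + 1) := rfl
        omega
      exact_mod_cast this
    calc _ = ∑ t ∈ Finset.Ioc (epochEnd K T L n) (min T (epochEnd K T L (n + 1))),
          (∫ ω, epochRegret T L μ rt I n ω ∂P) / epochLen K T L (n + 1) :=
          Finset.sum_congr rfl fun t ht => by
            rw [Finset.mem_Ioc, le_min_iff] at ht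
            exact h.round_regret (Finset.mem_Icc.2 ⟨by omega, ht.2.1⟩) ht.1 ht.2.2
      _ = ((min T (epochEnd K T L (n + 1)) - epochEnd K T L n : ℕ) : ℝ) *
          ((∫ ω, epochRegret T L μ rt I n ω ∂P) / epochLen K T L (n + 1)) := by
          rw [Finset.sum_const, Nat.card_Ioc, nsmul_eq_mul]
      _ ≤ epochLen K T L (n + 1) *
          ((∫ ω, epochRegret T L μ rt I n ω ∂P) / epochLen K T L (n + 1)) := by gcongr
      _ = _ := by field_simp

lemma sum_epochCorruption (M : ℕ) (ω : Ω) :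
    ∑ m ∈ Finset.range M, epochCorruption T L r rt m ω =
      ∑ t ∈ Finset.Ioc 0 (epochEnd K T L M), roundCorruption r rt t ω := by
  induction M with
  | zero => simp [epochEnd]
  | succ M ih =>
    rw [Finset.sum_range_succ, ih, epochCorruption,
      Finset.sum_Ioc_consecutive _ (Nat.zero_le _) (epochEnd_mono (Nat.le_succ M))]

lemma integrable_corruption (h : BoundedRun T L μ P r rt I H G) :
    Integrable (corruption T r rt) P :=
  integrable_finsetSum _ fun _ ht => h.integrable_roundCorruption ht

lemma corruption_nonneg (ω : Ω) : 0 ≤ corruption T r rt ω :=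
  Finset.sum_nonneg fun t _ => roundCorruption_nonneg t ω

lemma sum_integral_epochCorruption_le (h : BoundedRun T L μ P r rt I H G) {M : ℕ}
    (hM : epochEnd K T L M ≤ T) :
    ∑ m ∈ Finset.range M, ∫ ω, epochCorruption T L r rt m ω ∂P ≤ ∫ ω, corruption T r rt ω ∂P := by
  have hi : ∀ m ∈ Finset.range M, Integrable (epochCorruption T L r rt m) P := fun m hm =>
    h.integrable_epochCorruption ((epochEnd_mono (Finset.mem_range.1 hm)).trans hM)
  rw [← integral_finsetSum _ hi]
  refine integral_mono (integrable_finsetSum _ hi) h.integrable_corruption fun ω => ?_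
  simp only [sum_epochCorruption]
  refine Finset.sum_le_sum_of_subset_of_nonneg (fun t ht => ?_)
    fun t _ _ => roundCorruption_nonneg t ω
  rw [Finset.mem_Ioc] at ht
  exact Finset.mem_Icc.2 (by omega)

lemma exists_numEpochs (hT : 1 ≤ T) (hTL : T ≤ epochEnd K T L L) :
    ∃ M, M + 1 ≤ L ∧ (∀ m < M + 1, epochEnd K T L m < T) ∧ T ≤ epochEnd K T L (M + 1) := by
  have hex : ∃ m, T ≤ epochEnd K T L m := ⟨L, hTL⟩
  have h0 : Nat.find hex ≠ 0 := fun h0 => by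
    have := Nat.find_spec hex
    rw [h0, epochEnd] at this
    omega
  obtain ⟨M, hM⟩ := Nat.exists_eq_succ_of_ne_zero h0
  have h1 := Nat.find_min' hex hTL
  have h2 := Nat.find_spec hex
  rw [hM] at h1 h2
  exact ⟨M, h1, fun m hm => not_le.1 (Nat.find_min hex (by omega)), h2⟩

lemma regret_nonpos (h : BoundedRun T L μ P r rt I H G) (hT : 1 ≤ T)
    (hTL : T ≤ epochEnd K T L L) (hgap : ∀ k, (⨆ j, μ j) - μ k ≤ 0) : regret T P r I ≤ 0 := by
  obtain ⟨M, -, hM2, hM3⟩ := exists_numEpochs hT hTL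
  refine (h.regret_le_sum hM2 hM3).trans (Finset.sum_nonpos fun m _ => ?_)
  exact integral_nonpos fun ω => Finset.sum_nonpos fun k _ =>
    mul_nonpos_of_nonpos_of_nonneg (hgap k) (pulls_pos m k).le

lemma regret_le (h : BoundedRun T L μ P r rt I H G) (hT : 1 ≤ T)
    (hTL : T ≤ epochEnd K T L L) {D : ℝ} (hD : 0 < D)
    (hDle : ∀ k, 0 < (⨆ j, μ j) - μ k → D ≤ (⨆ j, μ j) - μ k) :
    regret T P r I ≤
      ∑ m ∈ Finset.range L, (38 * lam K T L (m + 1) * ∑ k, 1 / ((⨆ j, μ j) - μ k) +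
        (if 1 ≤ m ∧ base T L ^ m * D ≤ 1 then 2 * K * lam K T L (m + 1) / D else 0)) +
      504 * base T L ^ 2 * ∫ ω, corruption T r rt ω ∂P + 2016 * L := by
  obtain ⟨M, hM1, hM2, hM3⟩ := exists_numEpochs hT hTL
  obtain ⟨o, ho⟩ := exists_eq_ciSup_of_finite (f := μ)
  have hend : ∀ m ∈ Finset.range M, epochEnd K T L (m + 1) ≤ T := fun m hm =>
    (hM2 (m + 1) (by rw [Finset.mem_range] at hm; omega)).le
  have hb := base_pos (T := T) (L := L)
  have hK := one_le_cast_arms K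
  have hregint : ∀ m ∈ Finset.range (M + 1), Integrable (epochRegret T L μ rt I m) P :=
    fun m hm => h.integrable_epochRegret (hM2 m (Finset.mem_range.1 hm)).le
  set c : Ω → ℕ → ℝ := fun ω s => epochError T L μ r rt I (s - 1) ω with hc
  set A : ℕ → ℝ := fun m => 38 * lam K T L (m + 1) * ∑ k, 1 / ((⨆ j, μ j) - μ k) +
    (if 1 ≤ m ∧ base T L ^ m * D ≤ 1 then 2 * K * lam K T L (m + 1) / D else 0) with hA
  have hA0 : ∀ m, 0 ≤ A m := fun m => by
    have h1 := lam_pos (K := K) (T := T) (L := L) (m + 1)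
    have h2 : 0 ≤ ∑ k, 1 / ((⨆ j, μ j) - μ k) :=
      Finset.sum_nonneg fun k _ => one_div_nonneg.2 (sub_nonneg.2 (le_iSup_mean k))
    rw [hA]
    dsimp only
    split_ifs <;> positivity
  have herr : ∀ m ∈ Finset.range M, Integrable (fun ω =>
      (epochLen K T L (m + 1) : ℝ) * epochError T L μ r rt I m ω) P := fun m hm =>
    (h.integrable_epochError (hend m hm)).const_mul _
  have hpt : ∀ ω, ∑ m ∈ Finset.range (M + 1), epochRegret T L μ rt I m ω ≤
      ∑ m ∈ Finset.range (M + 1), A m + 252 * base T L ^ 2 *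
        ∑ m ∈ Finset.range M, epochLen K T L (m + 1) * epochError T L μ r rt I m ω := fun ω =>
    sum_sum_gap_mul_pulls_le (c := c ω) (fun m => epochError_nonneg (m - 1) ω)
      (fun m _ k => h.abs_reward_sub_le m k ω) (⨆ j, μ j) le_iSup_mean
      (ciSup_le fun j => (h.mean_mem j).2) (fun j => (h.mean_mem j).1) o ho D hD hDle
  have hint : ∫ ω, ∑ m ∈ Finset.range (M + 1), epochRegret T L μ rt I m ω ∂P ≤
      ∑ m ∈ Finset.range (M + 1), A m + 252 * base T L ^ 2 *
        ∑ m ∈ Finset.range M, epochLen K T L (m + 1) * ∫ ω, epochError T L μ r rt I m ω ∂P := by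
    refine (integral_mono (integrable_finsetSum _ hregint)
      ((integrable_const _).add ((integrable_finsetSum _ herr).const_mul _)) hpt).trans_eq ?_
    simp only [Pi.add_apply]
    rw [integral_add (integrable_const _) ((integrable_finsetSum _ herr).const_mul _),
      integral_const, integral_const_mul, integral_finsetSum _ herr]
    simp [integral_const_mul]
  have herrsum : ∑ m ∈ Finset.range M,
      epochLen K T L (m + 1) * ∫ ω, epochError T L μ r rt I m ω ∂P ≤
      2 * ∫ ω, corruption T r rt ω ∂P +
        ∑ m ∈ Finset.range M, epochLen K T L (m + 1) * delta K T L (m + 1) := by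
    refine (Finset.sum_le_sum fun m hm =>
      h.epochLen_mul_integral_epochError_le (hend m hm)).trans ?_
    rw [Finset.sum_add_distrib, ← Finset.mul_sum]
    gcongr
    exact h.sum_integral_epochCorruption_le (hM2 M (by omega)).le
  have hdelta : base T L ^ 2 *
      ∑ m ∈ Finset.range M, epochLen K T L (m + 1) * delta K T L (m + 1) ≤ 8 * L := by
    rw [Finset.mul_sum]
    calc _ ≤ ∑ _m ∈ Finset.range M, (8 : ℝ) :=
          Finset.sum_le_sum fun m _ => epochLen_mul_delta_le m
      _ = 8 * M := by simp [mul_comm]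
      _ ≤ 8 * L := by
          have : (M : ℝ) ≤ L := by exact_mod_cast (by omega : M ≤ L)
          linarith
  have hsub : ∑ m ∈ Finset.range (M + 1), A m ≤ ∑ m ∈ Finset.range L, A m :=
    Finset.sum_le_sum_of_subset_of_nonneg (Finset.range_subset_range.2 hM1) fun m _ _ => hA0 m
  have hreg := h.regret_le_sum hM2 hM3
  rw [← integral_finsetSum _ hregint] at hreg
  have hmul := mul_le_mul_of_nonneg_left herrsum (by positivity : 0 ≤ 252 * base T L ^ 2)
  linarith

end BoundedRun

section Clipping

/-- The projection of a reward vector to `[0, 1] ^ K`. -/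
noncomputable def clip {K : ℕ} {Ω : Type*} (r : ℕ → Ω → Fin K → ℝ) (t : ℕ) (ω : Ω) (k : Fin K) : ℝ :=
  max 0 (min 1 (r t ω k))

variable {K T L : ℕ} {Ω : Type*}

lemma clip_mem (r : ℕ → Ω → Fin K → ℝ) (t : ℕ) (ω : Ω) (k : Fin K) :
    clip r t ω k ∈ Set.Icc (0 : ℝ) 1 :=
  ⟨le_max_left _ _, max_le zero_le_one (min_le_left _ _)⟩

lemma clip_eq {r : ℕ → Ω → Fin K → ℝ} {t : ℕ} {ω : Ω} {k : Fin K}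
    (h : r t ω k ∈ Set.Icc (0 : ℝ) 1) : clip r t ω k = r t ω k := by
  rw [clip, min_eq_right h.2, max_eq_right h.1]

lemma measurable_clip {m : MeasurableSpace Ω} {r : ℕ → Ω → Fin K → ℝ} {t : ℕ}
    (h : Measurable (r t)) (k : Fin K) : Measurable fun ω => clip r t ω k :=
  measurable_const.max (measurable_const.min ((measurable_pi_apply k).comp h))

end Clipping

namespace IsRun

variable {K T L : ℕ} [NeZero K] {Ω : Type*} [mΩ : MeasurableSpace Ω]
  {ν : Measure (Fin K → ℝ)} {P : Measure Ω} {r rt : ℕ → Ω → Fin K → ℝ} {I : ℕ → Ω → Fin K}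

/-- The information just before the arm of round `t` is drawn. -/
abbrev preArm (r rt : ℕ → Ω → Fin K → ℝ) (I : ℕ → Ω → Fin K) (t : ℕ) : MeasurableSpace Ω :=
  history r rt I t ⊔ MeasurableSpace.comap (r t) inferInstance ⊔
    MeasurableSpace.comap (rt t) inferInstance

lemma history_mono : Monotone (history r rt I) := fun _ _ hst =>
  biSup_mono fun _ hi => Finset.Ico_subset_Ico_right hst hi

lemma le_history_succ {t : ℕ} (ht : 1 ≤ t) :
    MeasurableSpace.comap (r t) inferInstance ⊔ MeasurableSpace.comap (rt t) inferInstance ⊔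
      MeasurableSpace.comap (I t) inferInstance ≤ history r rt I (t + 1) :=
  le_iSup₂_of_le (f := fun s (_ : s ∈ Finset.Ico 1 (t + 1)) =>
    MeasurableSpace.comap (r s) inferInstance ⊔ MeasurableSpace.comap (rt s) inferInstance ⊔
      MeasurableSpace.comap (I s) inferInstance) t (Finset.mem_Ico.2 ⟨ht, Nat.lt_succ_self t⟩) le_rfl

lemma history_le (h : IsRun T L ν P r rt I) {t : ℕ} (ht : t ≤ T + 1) : history r rt I t ≤ mΩ :=
  iSup₂_le fun s hs => by
    have hs' : s ∈ Finset.Icc 1 T := by rw [Finset.mem_Ico] at hs; exact Finset.mem_Icc.2 (by omega)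
    exact sup_le (sup_le (h.measurable_reward s hs').comap_le (h.measurable_corrupted s hs').comap_le)
      (h.measurable_arm s hs').comap_le

lemma preArm_le (h : IsRun T L ν P r rt I) {t : ℕ} (ht : t ∈ Finset.Icc 1 T) :
    preArm r rt I t ≤ mΩ :=
  sup_le (sup_le (h.history_le (by rw [Finset.mem_Icc] at ht; omega))
    (h.measurable_reward t ht).comap_le) (h.measurable_corrupted t ht).comap_le

lemma ae_reward_mem (h : IsRun T L ν P r rt I) (hν : ∀ᵐ x ∂ν, ∀ k, x k ∈ Set.Icc (0 : ℝ) 1)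
    {t : ℕ} (ht : t ∈ Finset.Icc 1 T) : ∀ᵐ ω ∂P, ∀ k, r t ω k ∈ Set.Icc (0 : ℝ) 1 := by
  rw [← h.reward_law t ht] at hν
  exact ae_of_ae_map (h.measurable_reward t ht).aemeasurable hν

lemma ae_clip_reward_eq (h : IsRun T L ν P r rt I)
    (hν : ∀ᵐ x ∂ν, ∀ k, x k ∈ Set.Icc (0 : ℝ) 1) :
    ∀ᵐ ω ∂P, ∀ t ∈ Finset.Icc 1 T, ∀ k, clip r t ω k = r t ω k := by
  refine (Filter.eventually_all_finset _).2 fun t ht => ?_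
  exact (h.ae_reward_mem hν ht).mono fun ω hω k => clip_eq (hω k)

lemma ae_clip_corrupted_eq (h : IsRun T L ν P r rt I) :
    ∀ᵐ ω ∂P, ∀ t ∈ Finset.Icc 1 T, ∀ k, clip rt t ω k = rt t ω k := by
  refine (Filter.eventually_all_finset _).2 fun t ht => ?_
  exact (h.corrupted_mem t ht).mono fun ω hω k => clip_eq (hω k)

lemma integral_clip_reward (h : IsRun T L ν P r rt I)
    (hν : ∀ᵐ x ∂ν, ∀ k, x k ∈ Set.Icc (0 : ℝ) 1) {t : ℕ} (ht : t ∈ Finset.Icc 1 T) (k : Fin K) :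
    ∫ ω, clip r t ω k ∂P = mean ν k := by
  have h1 : ∫ ω, clip r t ω k ∂P = ∫ ω, r t ω k ∂P :=
    integral_congr_ae ((h.ae_reward_mem hν ht).mono fun ω hω => clip_eq (hω k))
  rw [h1, mean, ← h.reward_law t ht, integral_map (h.measurable_reward t ht).aemeasurable
    (measurable_pi_apply k).aestronglyMeasurable]

lemma mean_mem [IsProbabilityMeasure ν] (hν : ∀ᵐ x ∂ν, ∀ k, x k ∈ Set.Icc (0 : ℝ) 1)
    (k : Fin K) : mean ν k ∈ Set.Icc (0 : ℝ) 1 := by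
  refine ⟨integral_nonneg_of_ae (hν.mono fun x hx => (hx k).1), ?_⟩
  have hi : Integrable (fun x : Fin K → ℝ => x k) ν :=
    Integrable.of_bound (measurable_pi_apply k).aestronglyMeasurable 1 (hν.mono fun x hx => by
      rw [Real.norm_eq_abs, abs_of_nonneg (hx k).1]; exact (hx k).2)
  calc mean ν k ≤ ∫ _x, (1 : ℝ) ∂ν :=
        integral_mono_ae hi (integrable_const _) (hν.mono fun x hx => (hx k).2)
    _ = 1 := by simp

lemma boundedRun_clip [IsProbabilityMeasure ν] [IsProbabilityMeasure P]
    (h : IsRun T L ν P r rt I) (hν : ∀ᵐ x ∂ν, ∀ k, x k ∈ Set.Icc (0 : ℝ) 1) :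
    BoundedRun T L (mean ν) P (clip r) (clip rt) I (history r rt I) (preArm r rt I) where
  mono := history_mono
  le_G t := le_sup_left.trans le_sup_left
  G_le t ht := by
    have h1 := le_history_succ (r := r) (rt := rt) (I := I) (Finset.mem_Icc.1 ht).1
    exact sup_le (sup_le (history_mono (Nat.le_succ t))
      (le_sup_left.trans (le_sup_left.trans h1))) (le_sup_right.trans (le_sup_left.trans h1))
  H_le t ht := h.history_le ht
  measurable_reward t ht k := measurable_clip (m := preArm r rt I t)
    ((comap_measurable (r t)).mono (le_sup_right.trans le_sup_left) le_rfl) k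
  measurable_corrupted t ht k := measurable_clip (m := preArm r rt I t)
    ((comap_measurable (rt t)).mono le_sup_right le_rfl) k
  measurable_arm t ht := (comap_measurable (I t)).mono
    (le_sup_right.trans (le_history_succ (Finset.mem_Icc.1 ht).1)) le_rfl
  mean_mem := mean_mem hν
  reward_mem t ω k := clip_mem r t ω k
  corrupted_mem t ω k := clip_mem rt t ω k
  integral_mul_reward t ht k V hV _ := by
    have hle := h.history_le (t := t) (by rw [Finset.mem_Icc] at ht; omega)
    have hind : IndepFun (fun ω => clip r t ω k) V P := by
      rw [IndepFun_iff_Indep]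
      refine indep_of_indep_of_le_left (indep_of_indep_of_le_right (h.reward_indep t ht)
        hV.comap_le) ?_
      exact (measurable_clip (m := MeasurableSpace.comap (r t) inferInstance)
        (comap_measurable (r t)) k).comap_le
    have := hind.integral_fun_mul_eq_mul_integral
      (measurable_clip (h.measurable_reward t ht) k).aestronglyMeasurable
      (hV.mono hle le_rfl).aestronglyMeasurable
    rw [h.integral_clip_reward hν ht k] at this
    rw [← this]
    simp only [mul_comm]
  integral_mul_arm m t ht h1 h2 k Y hY hYb := by
    obtain ⟨B, hB⟩ := hYb
    have hle := h.preArm_le ht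
    have hlaw := h.arm_law (m + 1) (Nat.le_add_left 1 m) t ht h1 h2 k
    have hJ : Integrable ((I t ⁻¹' {k}).indicator fun _ => (1 : ℝ)) P :=
      (integrable_const (1 : ℝ)).indicator (h.measurable_arm t ht (measurableSet_singleton k))
    have hpull := condExp_stronglyMeasurable_mul_of_bound hle (μ := P) (f := Y)
      (g := (I t ⁻¹' {k}).indicator fun _ => (1 : ℝ)) hY.stronglyMeasurable hJ B
      (Filter.Eventually.of_forall hB)
    have hind : ∀ ω, (if I t ω = k then (1 : ℝ) else 0) =
        (I t ⁻¹' {k}).indicator (fun _ => (1 : ℝ)) ω := fun ω => by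
      by_cases hk : I t ω = k <;> simp [hk]
    simp only [hind]
    calc ∫ ω, Y ω * (I t ⁻¹' {k}).indicator (fun _ => (1 : ℝ)) ω ∂P
        = ∫ ω, (P[Y * (I t ⁻¹' {k}).indicator fun _ => (1 : ℝ) | preArm r rt I t]) ω ∂P :=
          (integral_condExp hle).symm
      _ = _ := integral_congr_ae ?_
    filter_upwards [hpull, hlaw, h.ae_clip_corrupted_eq] with ω e1 e2 e3
    rw [e1, Pi.mul_apply, e2]
    congr 1
    unfold armProb
    rw [Nat.add_sub_cancel]
    have he : estimates T L (fun s => I s ω) (fun s => rt s ω (I s ω)) m =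
        estimates T L (fun s => I s ω) (fun s => clip rt s ω (I s ω)) m :=
      estimates_congr m fun s hs => (e3 s (by
        rw [Finset.mem_Icc] at hs ht ⊢; omega) _).symm
    rw [he]

lemma regret_clip (h : IsRun T L ν P r rt I) (hν : ∀ᵐ x ∂ν, ∀ k, x k ∈ Set.Icc (0 : ℝ) 1) :
    regret T P (clip r) I = regret T P r I := by
  unfold regret
  congr 1
  · congr 1
    funext k
    refine integral_congr_ae ((h.ae_clip_reward_eq hν).mono fun ω hω => ?_)
    exact Finset.sum_congr rfl fun t ht => hω t ht k
  · refine integral_congr_ae ((h.ae_clip_reward_eq hν).mono fun ω hω => ?_)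
    exact Finset.sum_congr rfl fun t ht => hω t ht _

lemma integral_corruption_clip (h : IsRun T L ν P r rt I)
    (hν : ∀ᵐ x ∂ν, ∀ k, x k ∈ Set.Icc (0 : ℝ) 1) :
    ∫ ω, corruption T (clip r) (clip rt) ω ∂P = ∫ ω, corruption T r rt ω ∂P := by
  refine integral_congr_ae ?_
  filter_upwards [h.ae_clip_reward_eq hν, h.ae_clip_corrupted_eq] with ω e1 e2
  refine Finset.sum_congr rfl fun t ht => ?_
  simp only [e1 t ht, e2 t ht]

end IsRun

section Comparison

variable {K T L : ℕ}

lemma base_le (hT : 1 ≤ T) : base T L ≤ 2 * (T : ℝ) ^ (1 / (2 * ((L : ℝ) + 3))) := by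
  have h1 : (1 : ℝ) ≤ (T : ℝ) ^ (1 / (2 * ((L : ℝ) + 3))) :=
    Real.one_le_rpow (by exact_mod_cast hT) (by positivity)
  exact max_le (by linarith) (by linarith)

lemma base_sq_le (hT : 1 ≤ T) : base T L ^ 2 ≤ 4 * (T : ℝ) ^ (1 / ((L : ℝ) + 3)) := by
  have hb := base_pos (T := T) (L := L)
  calc base T L ^ 2 ≤ (2 * (T : ℝ) ^ (1 / (2 * ((L : ℝ) + 3)))) ^ 2 := by
        gcongr; exact base_le hT
    _ = 4 * ((T : ℝ) ^ (1 / (2 * ((L : ℝ) + 3)))) ^ 2 := by ring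
    _ = _ := by
        rw [← Real.rpow_mul_natCast (Nat.cast_nonneg T)]
        congr 2
        push_cast
        field_simp

lemma base_pow_eight_le (hT : 1 ≤ T) :
    base T L ^ 8 ≤ 256 * (T : ℝ) ^ (4 / ((L : ℝ) + 3)) := by
  have hb := base_pos (T := T) (L := L)
  calc base T L ^ 8 ≤ (2 * (T : ℝ) ^ (1 / (2 * ((L : ℝ) + 3)))) ^ 8 := by
        gcongr; exact base_le hT
    _ = 256 * ((T : ℝ) ^ (1 / (2 * ((L : ℝ) + 3)))) ^ 8 := by ring
    _ = _ := by
        rw [← Real.rpow_mul_natCast (Nat.cast_nonneg T)]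
        congr 2
        push_cast
        field_simp
        norm_num

lemma mul_log_two_le (hLT : (L : ℝ) ≤ Real.logb 2 T) :
    L * Real.log 2 ≤ Real.log T := by
  rw [Real.logb, le_div_iff₀ (Real.log_pos one_lt_two)] at hLT
  exact hLT

lemma mul_log_base_le (hT : 1 ≤ T) (hL : 1 ≤ L) (hLT : (L : ℝ) ≤ Real.logb 2 T) :
    ((L : ℝ) + 4) * Real.log (base T L) ≤ 5 * Real.log T := by
  have h1 := mul_log_two_le hLT
  have hL' : (1 : ℝ) ≤ L := by exact_mod_cast hL
  have h2 : 0 < Real.log 2 := Real.log_pos one_lt_two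
  have hT0 : (0 : ℝ) < T := by exact_mod_cast hT
  have hlT : 0 ≤ Real.log T := Real.log_nonneg (by exact_mod_cast hT)
  rcases max_choice ((T : ℝ) ^ (1 / (2 * ((L : ℝ) + 3)))) 2 with h | h
  · rw [base, h, Real.log_rpow hT0, ← mul_assoc]
    gcongr
    rw [mul_one_div, div_le_iff₀ (by positivity)]
    linarith
  · rw [base, h]
    nlinarith

variable [NeZero K]

lemma lam_succ_le (hT : 1 ≤ T) (hL : 1 ≤ L) (hLT : (L : ℝ) ≤ Real.logb 2 T) {m : ℕ}
    (hm : m < L) :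
    lam K T L (m + 1) ≤ 5120 * ((T : ℝ) ^ (4 / ((L : ℝ) + 3)) * Real.log (K * T)) := by
  have h1 := base_pow_eight_le (T := T) (L := L) hT
  have h2 := logTerm_le (K := K) (T := T) (L := L) (m + 1)
  have h3 := mul_log_base_le hT hL hLT
  have hb := log_base_pos (T := T) (L := L)
  have hK := log_cast_arms_nonneg K
  have hm' : ((m + 1 : ℕ) : ℝ) ≤ L := by exact_mod_cast hm
  have hT0 : (0 : ℝ) < T := by exact_mod_cast hT
  have hlog : Real.log (K * T) = Real.log K + Real.log T :=
    Real.log_mul (by have := one_le_cast_arms K; positivity) hT0.ne'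
  have h4 : logTerm K T L (m + 1) ≤ 20 * Real.log (K * T) := by
    refine h2.trans ?_
    have : (((m + 1 : ℕ) : ℝ) + 4) * Real.log (base T L) ≤ ((L : ℝ) + 4) * Real.log (base T L) := by
      gcongr
    rw [logScale, hlog]
    linarith
  rw [lam_eq]
  calc _ ≤ (256 * (T : ℝ) ^ (4 / ((L : ℝ) + 3))) * (20 * Real.log (K * T)) :=
        mul_le_mul h1 h4 (logTerm_pos _).le (by positivity)
    _ = _ := by ring

lemma lam_succ_le_of_base_pow_le (hT : 1 ≤ T) {m : ℕ} (hm : 1 ≤ m) {D : ℝ} (hD : 0 < D)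
    (h : base T L ^ m * D ≤ 1) :
    lam K T L (m + 1) ≤ 6144 * ((T : ℝ) ^ (4 / ((L : ℝ) + 3)) * Real.log (K / D)) := by
  have h1 := base_pow_eight_le (T := T) (L := L) hT
  have h2 := logTerm_le (K := K) (T := T) (L := L) (m + 1)
  have hb := log_base_pos (T := T) (L := L)
  have hK := log_cast_arms_nonneg K
  have hb0 := base_pos (T := T) (L := L)
  have h3 : m * Real.log (base T L) ≤ -Real.log D := by
    have := Real.log_le_log (by positivity) h
    rw [Real.log_mul (by positivity) hD.ne', Real.log_pow, Real.log_one] at this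
    linarith
  have hlog : Real.log (K / D) = Real.log K - Real.log D :=
    Real.log_div (by have := one_le_cast_arms K; positivity) hD.ne'
  have h4 : logTerm K T L (m + 1) ≤ 24 * Real.log (K / D) := by
    refine h2.trans ?_
    have hm' : (1 : ℝ) ≤ m := by exact_mod_cast hm
    have : (((m + 1 : ℕ) : ℝ) + 4) * Real.log (base T L) ≤ 6 * (m * Real.log (base T L)) := by
      push_cast
      nlinarith
    rw [logScale, hlog]
    linarith
  rw [lam_eq]
  calc _ ≤ (256 * (T : ℝ) ^ (4 / ((L : ℝ) + 3))) * (24 * Real.log (K / D)) :=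
        mul_le_mul h1 h4 (logTerm_pos _).le (by positivity)
    _ = _ := by ring

lemma card_base_pow_le (hL : 1 ≤ L) (hLT : (L : ℝ) ≤ Real.logb 2 T) {D : ℝ}
    (hD : 0 < D) (hD1 : D ≤ 1) :
    (((Finset.range L).filter fun m => 1 ≤ m ∧ base T L ^ m * D ≤ 1).card : ℝ) ≤
      3 * (Real.log T * Real.log (1 / D) / L) := by
  have hb := log_base_pos (T := T) (L := L)
  have hb2 := log_two_le_log_base (T := T) (L := L)
  have hb0 := base_pos (T := T) (L := L)
  have h2 : (0.69 : ℝ) < Real.log 2 := by linarith [Real.log_two_gt_d9]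
  have hL' : (0 : ℝ) < L := by exact_mod_cast hL
  have hlog : Real.log (1 / D) = -Real.log D := by rw [one_div, Real.log_inv]
  have hlD : 0 ≤ Real.log (1 / D) := by
    rw [hlog]; linarith [Real.log_nonpos hD.le hD1]
  have h3 : Real.log 2 ≤ Real.log T / L := by
    rw [le_div_iff₀ hL', mul_comm]
    exact mul_log_two_le hLT
  have hsub : (Finset.range L).filter (fun m => 1 ≤ m ∧ base T L ^ m * D ≤ 1) ⊆
      Finset.Icc 1 ⌊Real.log (1 / D) / Real.log (base T L)⌋₊ := fun m hm => by
    obtain ⟨-, hm1, hm2⟩ := Finset.mem_filter.1 hm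
    refine Finset.mem_Icc.2 ⟨hm1, Nat.le_floor ?_⟩
    have := Real.log_le_log (by positivity) hm2
    rw [Real.log_mul (by positivity) hD.ne', Real.log_pow, Real.log_one] at this
    rw [le_div_iff₀ hb, hlog]
    linarith
  have hcard := Finset.card_le_card hsub
  rw [Nat.card_Icc, Nat.add_sub_cancel] at hcard
  calc _ ≤ ((⌊Real.log (1 / D) / Real.log (base T L)⌋₊ : ℕ) : ℝ) := by exact_mod_cast hcard
    _ ≤ Real.log (1 / D) / Real.log (base T L) := Nat.floor_le (by positivity)
    _ ≤ Real.log (1 / D) * (3 * (Real.log T / L)) := by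
        rw [div_eq_mul_inv]
        gcongr
        rw [inv_le_iff_one_le_mul₀ hb]
        have : (0.69 : ℝ) * 0.69 ≤ Real.log T / L * Real.log (base T L) :=
          mul_le_mul (by linarith) (by linarith) (by norm_num) (by linarith)
        linarith
    _ = _ := by ring

lemma sum_ite_le (hT : 1 ≤ T) (hL : 1 ≤ L) (hLT : (L : ℝ) ≤ Real.logb 2 T) {D : ℝ}
    (hD : 0 < D) (hD1 : D ≤ 1) :
    ∑ m ∈ Finset.range L,
        (if 1 ≤ m ∧ base T L ^ m * D ≤ 1 then 2 * K * lam K T L (m + 1) / D else 0) ≤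
      36864 * ((T : ℝ) ^ (4 / ((L : ℝ) + 3)) *
        (K * Real.log T * Real.log (1 / D) * Real.log (K / D) / (L * D))) := by
  have hK := one_le_cast_arms K
  have hL' : (0 : ℝ) < L := by exact_mod_cast hL
  have hlogK : 0 ≤ Real.log (K / D) :=
    Real.log_nonneg (by rw [le_div_iff₀ hD]; linarith)
  rw [← Finset.sum_filter]
  calc _ ≤ ∑ _m ∈ (Finset.range L).filter (fun m => 1 ≤ m ∧ base T L ^ m * D ≤ 1),
        2 * K * (6144 * ((T : ℝ) ^ (4 / ((L : ℝ) + 3)) * Real.log (K / D))) / D :=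
        Finset.sum_le_sum fun m hm => by
          obtain ⟨-, hm1, hm2⟩ := Finset.mem_filter.1 hm
          have := lam_succ_le_of_base_pow_le (K := K) hT hm1 hD hm2
          gcongr
    _ = (((Finset.range L).filter fun m => 1 ≤ m ∧ base T L ^ m * D ≤ 1).card : ℝ) *
        (2 * K * (6144 * ((T : ℝ) ^ (4 / ((L : ℝ) + 3)) * Real.log (K / D))) / D) := by
        rw [Finset.sum_const, nsmul_eq_mul]
    _ ≤ 3 * (Real.log T * Real.log (1 / D) / L) *
        (2 * K * (6144 * ((T : ℝ) ^ (4 / ((L : ℝ) + 3)) * Real.log (K / D))) / D) :=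
        mul_le_mul_of_nonneg_right (card_base_pow_le hL hLT hD hD1) (by positivity)
    _ = _ := by
        field_simp
        ring

lemma gap_nonneg (ν : Measure (Fin K → ℝ)) (k : Fin K) : 0 ≤ gap ν k :=
  sub_nonneg.2 (BoundedRun.le_iSup_mean k)

lemma finite_setOf_gap (ν : Measure (Fin K → ℝ)) :
    {x | ∃ k, 0 < gap ν k ∧ x = gap ν k}.Finite :=
  (Set.finite_range (gap ν)).subset fun _ ⟨k, _, hk⟩ => ⟨k, hk.symm⟩

lemma minGap_le {ν : Measure (Fin K → ℝ)} {k : Fin K} (hk : 0 < gap ν k) :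
    minGap ν ≤ gap ν k :=
  csInf_le (finite_setOf_gap ν).bddBelow ⟨k, hk, rfl⟩

lemma minGap_pos {ν : Measure (Fin K → ℝ)} {k : Fin K} (hk : 0 < gap ν k) : 0 < minGap ν := by
  obtain ⟨j, hj, hj'⟩ := Set.Nonempty.csInf_mem (s := {x | ∃ k, 0 < gap ν k ∧ x = gap ν k})
    ⟨gap ν k, k, hk, rfl⟩ (finite_setOf_gap ν)
  rw [minGap, hj']
  exact hj

end Comparison

end BBBarbat

theorem theorem3 :
    ∃ c : ℝ, 0 < c ∧
      ∀ (K T L : ℕ) [NeZero K], 1 ≤ L → (L : ℝ) ≤ Real.logb 2 T →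
      ∀ (ν : Measure (Fin K → ℝ)) [IsProbabilityMeasure ν],
        (∀ᵐ x ∂ν, ∀ k, x k ∈ Set.Icc (0 : ℝ) 1) →
      ∀ (Ω : Type*) [MeasurableSpace Ω] (P : Measure Ω) [IsProbabilityMeasure P]
        (r rt : ℕ → Ω → Fin K → ℝ) (I : ℕ → Ω → Fin K),
        BBBarbat.IsRun T L ν P r rt I →
        T ≤ BBBarbat.epochEnd K T L L ∧
        BBBarbat.regret T P r I ≤
          c * ((∫ ω, BBBarbat.corruption T r rt ω ∂P) * (T : ℝ) ^ (1 / ((L : ℝ) + 3)) +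
            (T : ℝ) ^ (4 / ((L : ℝ) + 3)) *
              ((∑ k with 0 < BBBarbat.gap ν k,
                  (L : ℝ) * Real.log (K * T) / BBBarbat.gap ν k) +
                (K : ℝ) * Real.log T * Real.log (1 / BBBarbat.minGap ν) *
                  Real.log (K / BBBarbat.minGap ν) / (L * BBBarbat.minGap ν))) := by
  refine ⟨200000, by norm_num, ?_⟩
  intro K T L _ hL hLT ν _ hν Ω _ P _ r rt I h
  have hTL : T ≤ BBBarbat.epochEnd K T L L := BBBarbat.horizon_le_epochEnd hL
  refine ⟨hTL, ?_⟩
  have hL' : (1 : ℝ) ≤ L := by exact_mod_cast hL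
  have hT2 : 2 ≤ T := by
    by_contra! hlt
    have : T = 0 ∨ T = 1 := by omega
    rcases this with rfl | rfl <;> norm_num at hLT <;> linarith
  have hT : 1 ≤ T := by omega
  have hT2' : (2 : ℝ) ≤ T := by exact_mod_cast hT2
  have hK := BBBarbat.one_le_cast_arms K
  have hb := h.boundedRun_clip hν
  have hreg0 := hb.regret_nonpos hT hTL
  have hreg := fun hD hDle => hb.regret_le hT hTL (D := BBBarbat.minGap ν) hD hDle
  rw [h.regret_clip hν] at hreg0 hreg
  rw [h.integral_corruption_clip hν] at hreg
  have hC : 0 ≤ ∫ ω, BBBarbat.corruption T r rt ω ∂P :=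
    integral_nonneg fun ω => BBBarbat.BoundedRun.corruption_nonneg ω
  set C := ∫ ω, BBBarbat.corruption T r rt ω ∂P
  have hX : 0 ≤ (T : ℝ) ^ (1 / ((L : ℝ) + 3)) := by positivity
  have hZ : 1 ≤ (T : ℝ) ^ (4 / ((L : ℝ) + 3)) := Real.one_le_rpow (by linarith) (by positivity)
  have hsq := BBBarbat.base_sq_le (T := T) (L := L) hT
  have hlog : (0.69 : ℝ) < Real.log (K * T) := by
    have h1 : Real.log 2 ≤ Real.log (K * T) := Real.log_le_log two_pos (by nlinarith)
    linarith [Real.log_two_gt_d9]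
  by_cases hex : ∃ k, 0 < BBBarbat.gap ν k
  · obtain ⟨k₀, hk₀⟩ := hex
    have hD := BBBarbat.minGap_pos hk₀
    have hgap1 : ∀ k, BBBarbat.gap ν k ≤ 1 := fun k => by
      have h1 : (⨆ j, BBBarbat.mean ν j) ≤ 1 :=
        ciSup_le fun j => (BBBarbat.IsRun.mean_mem hν j).2
      have h2 := (BBBarbat.IsRun.mean_mem hν k).1
      unfold BBBarbat.gap
      linarith
    have hD1 : BBBarbat.minGap ν ≤ 1 := (BBBarbat.minGap_le hk₀).trans (hgap1 k₀)
    have hreg := hreg hD fun k hk => BBBarbat.minGap_le hk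
    rw [Finset.sum_add_distrib] at hreg
    have hite := BBBarbat.sum_ite_le (K := K) hT hL hLT hD hD1
    change _ ≤ ∑ m ∈ Finset.range L, 38 * BBBarbat.lam K T L (m + 1) *
      ∑ k, 1 / BBBarbat.gap ν k + _ + _ + _ at hreg
    have hS : ∑ k with 0 < BBBarbat.gap ν k, (L : ℝ) * Real.log (K * T) / BBBarbat.gap ν k =
        L * Real.log (K * T) * ∑ k, 1 / BBBarbat.gap ν k := by
      rw [Finset.mul_sum, Finset.sum_filter]
      refine Finset.sum_congr rfl fun k _ => ?_
      split_ifs with hk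
      · ring
      · rw [le_antisymm (not_lt.1 hk) (BBBarbat.gap_nonneg ν k)]; simp
    have hS1 : 1 ≤ ∑ k, 1 / BBBarbat.gap ν k :=
      le_trans (by rw [le_div_iff₀ hk₀]; linarith [hgap1 k₀])
        (Finset.single_le_sum (f := fun k => 1 / BBBarbat.gap ν k)
          (fun k _ => one_div_nonneg.2 (BBBarbat.gap_nonneg ν k)) (Finset.mem_univ k₀))
    rw [hS]
    set S := ∑ k, 1 / BBBarbat.gap ν k
    set X := (T : ℝ) ^ (1 / ((L : ℝ) + 3))
    set Z := (T : ℝ) ^ (4 / ((L : ℝ) + 3))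
    set B := (K : ℝ) * Real.log T * Real.log (1 / BBBarbat.minGap ν) *
      Real.log (K / BBBarbat.minGap ν) / (L * BBBarbat.minGap ν)
    have hB : 0 ≤ B := by
      have h1 : 0 ≤ Real.log T := Real.log_nonneg (by linarith)
      have h2 : 0 ≤ Real.log (1 / BBBarbat.minGap ν) :=
        Real.log_nonneg (by rw [le_div_iff₀ hD]; linarith)
      have h3 : 0 ≤ Real.log (K / BBBarbat.minGap ν) :=
        Real.log_nonneg (by rw [le_div_iff₀ hD]; linarith)
      positivity
    have hfirst : ∑ m ∈ Finset.range L, 38 * BBBarbat.lam K T L (m + 1) * S ≤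
        194560 * (Z * (L * Real.log (K * T) * S)) := by
      calc _ ≤ ∑ _m ∈ Finset.range L, 38 * (5120 * (Z * Real.log (K * T))) * S :=
            Finset.sum_le_sum fun m hm => by
              have := BBBarbat.lam_succ_le (K := K) hT hL hLT (Finset.mem_range.1 hm)
              gcongr
        _ = _ := by
            rw [Finset.sum_const, Finset.card_range, nsmul_eq_mul]
            ring
    have hlast : (L : ℝ) ≤ 2 * (Z * (L * Real.log (K * T) * S)) := by
      have h1 : 0.69 * 1 ≤ Real.log (K * T) * S :=
        mul_le_mul hlog.le hS1 zero_le_one (by linarith)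
      have h2 : 1 * (0.69 * 1) ≤ Z * (Real.log (K * T) * S) :=
        mul_le_mul hZ h1 (by norm_num) (by linarith)
      calc (L : ℝ) ≤ L * (2 * (Z * (Real.log (K * T) * S))) :=
            le_mul_of_one_le_right (by linarith) (by linarith)
        _ = _ := by ring
    have hcor : 504 * BBBarbat.base T L ^ 2 * C ≤ 2016 * (C * X) := by
      calc _ ≤ 504 * (4 * X) * C := by gcongr
        _ = _ := by ring
    have hCX : 0 ≤ C * X := mul_nonneg hC hX
    have hZB : 0 ≤ Z * B := mul_nonneg (by linarith) hB
    have hZA : 0 ≤ Z * (L * Real.log (K * T) * S) := by linarith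
    linarith
  · push Not at hex
    refine (hreg0 hex).trans ?_
    have hempty : {x | ∃ k, 0 < BBBarbat.gap ν k ∧ x = BBBarbat.gap ν k} = ∅ := by
      ext x
      simp only [Set.mem_ofPred_eq, Set.mem_empty_iff_false, iff_false, not_exists, not_and]
      exact fun k hk => absurd hk (not_lt.2 (hex k))
    have hmin : BBBarbat.minGap ν = 0 := by rw [BBBarbat.minGap, hempty, Real.sInf_empty]
    rw [hmin, mul_zero, div_zero, add_zero]
    have hsum : 0 ≤ ∑ k with 0 < BBBarbat.gap ν k,
        (L : ℝ) * Real.log (K * T) / BBBarbat.gap ν k :=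
      Finset.sum_nonneg fun k _ => div_nonneg (mul_nonneg (by linarith) (by linarith))
        (BBBarbat.gap_nonneg ν k)
    have h1 : 0 ≤ C * (T : ℝ) ^ (1 / ((L : ℝ) + 3)) := mul_nonneg hC hX
    have h2 := mul_nonneg (zero_le_one.trans hZ) hsum
    linarith
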